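/- Let $k$ be an algebraically closed field of characteristic $2$ and let $R$ be a complete discrete valuation ring of characteristic $0$ with residue field $k$ and uniformizer $\pi$. Let $r\ge 3$ be an integer and suppose that $R$ contains an element $\rho$ with $\rho^{2r-1}=2$. Let $\alpha\in k^*$, $\beta\in k$, $A\in R^*$, and let $U\in R^*$ be any element such that $-AU^2\equiv\alpha \pmod \pi$ and $U-A\in R^*$. Then there exist a complete discrete valuation ring $R'\supseteq R$, finite over $R$ and with the same residue field $k$, and a unit $V\in (R')^*$ with the following property. Put $$T_1=0,\quad T_2=\rho^{4r-4}A,\quad T_3=\rho U,\quad T_4=\rho U+\rho^{4r-4}V .$$ Then the cover $Y^2=\prod_{i=1}^4(1-T_iT^{-1})$ of $\mathbb{P}^1_{R'}$ has good reduction, with reduction $z^2-z=\frac{\alpha}{t^3}+\frac{\beta}{t}$. That is, with $K'=\mathrm{Frac}(R')$, the normalization $X$ of $\mathbb{P}^1_{R'}$ (with coordinate $T$) in $K'(T)[Y]/\bigl(Y^2-\prod_{i=1}^4(1-T_iT^{-1})\bigr)$ is smooth over $R'$, and its special fibre $X\times_{R'}k$ is isomorphic, as a cover of $\mathbb{P}^1_k$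 (with coordinate $t$, the reduction of $T$), to the normalization of $\mathbb{P}^1_k$ in $k(t)[z]/\bigl(z^2-z-\frac{\alpha}{t^3}-\frac{\beta}{t}\bigr)$. -/

import Mathlib

universe u v

open Polynomial TensorProduct

noncomputable section

namespace DoubleCover

variable (R : Type*) {K : Type*} [CommRing R] [Field K] [Algebra R K]

/-- Let `K` be a field over `R` and `p` a polynomial over `K(T)`; think of the cover of the
projective line with function ring `K(T)[Y]/(p)`.  For `s ⊆ K(T)`, this is the integral closure of
the ring `R[s] ⊆ K(T)` in `K(T)[Y]/(p)`.  If `Spec R[s]` is an open part of `ℙ¹_R`,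
this is the coordinate ring of the normalization of `ℙ¹_R` in `K(T)[Y]/(p)` over that part. -/
def chart (p : (RatFunc K)[X]) (s : Set (RatFunc K)) : Subalgebra R (AdjoinRoot p) :=
  (integralClosure (Algebra.adjoin R s) (AdjoinRoot p)).restrictScalars R

variable (K) in
/-- The coordinate `T` on the chart `ℙ¹ ∖ {∞}`. -/
abbrev nearZero : Set (RatFunc K) := {RatFunc.X}

variable (K) in
/-- The coordinate `T⁻¹` on the chart `ℙ¹ ∖ {0}`. -/
abbrev nearInfty : Set (RatFunc K) := {RatFunc.X⁻¹}

variable (K) in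
/-- The generators `T`, `T⁻¹` of the coordinate ring of the overlap `ℙ¹ ∖ {0, ∞}`. -/
abbrev overlap : Set (RatFunc K) := {RatFunc.X, RatFunc.X⁻¹}

variable {R} in
theorem chart_mono (p : (RatFunc K)[X]) {s s' : Set (RatFunc K)} (h : s ⊆ s') :
    chart R p s ≤ chart R p s' := by
  rintro x ⟨f, hf, hx⟩
  have hle : Algebra.adjoin R s ≤ Algebra.adjoin R s' := Algebra.adjoin_mono h
  refine ⟨f.map (Subalgebra.inclusion hle).toRingHom, hf.map _, ?_⟩
  rw [Polynomial.eval₂_map]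
  exact hx

variable {R} in
theorem algebraMap_mem_chart (p : (RatFunc K)[X]) {s : Set (RatFunc K)} {x : RatFunc K}
    (hx : x ∈ s) : algebraMap (RatFunc K) (AdjoinRoot p) x ∈ chart R p s :=
  isIntegral_algebraMap (R := Algebra.adjoin R s) (A := AdjoinRoot p)
    (x := ⟨x, Algebra.subset_adjoin hx⟩)

/-- An element of `K(T)` that generates the coordinate ring of a chart of `ℙ¹`, as a function on
the part of the normalization above that chart. -/
def coord (p : (RatFunc K)[X]) {s : Set (RatFunc K)} {x : RatFunc K} (hx : x ∈ s) : chart R p s :=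
  ⟨algebraMap (RatFunc K) (AdjoinRoot p) x, algebraMap_mem_chart p hx⟩

/-- The restriction of functions from above a chart of `ℙ¹` to above a smaller one. -/
def res (p : (RatFunc K)[X]) {s s' : Set (RatFunc K)} (h : s ⊆ s') :
    chart R p s →ₐ[R] chart R p s' :=
  Subalgebra.inclusion (chart_mono p h)

/-- The cover of `ℙ¹_R` with generic fibre `p(T, Y) = 0` (over the fraction field `K` of `R`) has
good reduction: the normalization of `ℙ¹_R` in `K(T)[Y]/(p)` is smooth over `R`. -/
structure HasGoodReduction (p : (RatFunc K)[X]) : Prop where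
  smooth_zero : Algebra.Smooth R (chart R p (nearZero K))
  smooth_infty : Algebra.Smooth R (chart R p (nearInfty K))

/-- The special fibre `X ×_R k` of the normalization `X` of `ℙ¹_R` in `K(T)[Y]/(p)` is isomorphic,
as a cover of `ℙ¹_k`, to the normalization of `ℙ¹_k` in `k(t)[z]/(q)`: the isomorphism is given by
`k`-algebra isomorphisms above the two standard charts and their overlap, which are compatible with
restriction and match the coordinates `T` and `t`. -/
def HasSpecialFibre {k : Type*} [Field k] [Algebra R k]
    (p : (RatFunc K)[X]) (q : (RatFunc k)[X]) : Prop :=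
  ∃ (e₀ : (k ⊗[R] chart R p (nearZero K)) ≃ₐ[k] chart k q (nearZero k))
    (e₁ : (k ⊗[R] chart R p (nearInfty K)) ≃ₐ[k] chart k q (nearInfty k))
    (e₂ : (k ⊗[R] chart R p (overlap K)) ≃ₐ[k] chart k q (overlap k)),
    (∀ x : chart R p (nearZero K),
      e₂ (1 ⊗ₜ res R p (by simp) x) = res k q (by simp) (e₀ (1 ⊗ₜ x))) ∧
    (∀ x : chart R p (nearInfty K),
      e₂ (1 ⊗ₜ res R p (by simp) x) = res k q (by simp) (e₁ (1 ⊗ₜ x))) ∧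
    e₀ (1 ⊗ₜ coord R p (Set.mem_singleton RatFunc.X)) =
      coord k q (Set.mem_singleton RatFunc.X) ∧
    e₁ (1 ⊗ₜ coord R p (Set.mem_singleton RatFunc.X⁻¹)) =
      coord k q (Set.mem_singleton RatFunc.X⁻¹)

/-- The polynomial `Y² - ∏ᵢ (1 - Tᵢ T⁻¹)` over `K(T)`, for `T₁, …, Tₙ ∈ R`. -/
def kummer (K : Type*) [Field K] [Algebra R K] {n : ℕ} (T : Fin n → R) : (RatFunc K)[X] :=
  X ^ 2 - C (∏ i, (1 - algebraMap R (RatFunc K) (T i) * RatFunc.X⁻¹))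

/-- The polynomial `z² - z - (α/t³ + β/t)` over `k(t)`. -/
def artinSchreier {k : Type*} [Field k] (α β : k) : (RatFunc k)[X] :=
  X ^ 2 - X - C (RatFunc.C α / RatFunc.X ^ 3 + RatFunc.C β / RatFunc.X)

end DoubleCover

end

/-! Put x = T⁻¹, so that the cover is Y² = f(x) = (1 - e₁x)(1 - e₂x)(1 - e₃x). If f = H² + 4g with H
= 1 + dx and g = βx + c₂x² + c₃x³, then z = (Y - H)/2 satisfies z² + Hz = g. If moreover d and c₂
vanish in k and c₃ maps to α, this reduces to z² + z = αx³ + βx, which is the Artin–Schreier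
equation because signs do not matter in characteristic 2.

To find such a decomposition, let σ² = ρ, so that 2 = σ^(4r-2) and ρ^(4r-4) = 4/σ⁴, and try d = -σ²U
+ 2w/σ. The coefficient of x then forces V = -A - σ³w - σ⁴β. In the coefficient of x² the only
dangerous terms are 4UV/σ² and 4w²/σ², which cancel when w² = UV. Together these give a monic
quadratic equation for w. Adjoining σ and w to the fraction field and taking the integral closure of
R gives R', and c₂, c₃ come out integral with the right reductions (`isSplit_of_two_eq`).

It remains to see that z² + Hz = g, and its transform by y = T²z on the other chart, describe the
normalization and are smooth. Normality is tested at the primes q of a polynomial ring, by trace and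
norm (`QuadraticAlgebra.IsNormal.exists_of_isIntegral`): for q ∤ 2 a failure would put q² in the
discriminant, whose roots are separated away from 2; for q ∣ 2 the linear coefficient H is prime to
q. Smoothness follows from a Weierstrass discriminant which reduces to α⁴. Since the same equations
with d = c₂ = 0 present the target cover over k, the special fibre is obtained by reducing
coefficients (`HasSpecialFibre.of_charts`). -/

noncomputable section

/-! ### Finite extensions of complete discrete valuation rings -/

/-- A finite module over an adically complete noetherian ring is adically complete. -/
theorem IsAdicComplete.of_module_finite {R M : Type u} [CommRing R] [IsNoetherianRing R]
    (I : Ideal R) [IsAdicComplete I R] [AddCommGroup M] [Module R M] [Module.Finite R M]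
    [IsHausdorff I M] : IsAdicComplete I M := by
  rw [← AdicCompletion.of_bijective_iff]
  refine ⟨AdicCompletion.of_injective I M, fun x => ?_⟩
  obtain ⟨t, rfl⟩ :=
    (AdicCompletion.ofTensorProduct_bijective_of_finite_of_isNoetherian I M).2 x
  induction t with
  | zero => exact ⟨0, by simp⟩
  | add a b ha hb =>
    obtain ⟨a', ha⟩ := ha
    obtain ⟨b', hb⟩ := hb
    exact ⟨a' + b', by rw [map_add, map_add, ha, hb]⟩
  | tmul a m =>
    obtain ⟨r, rfl⟩ := AdicCompletion.of_surjective I R a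
    refine ⟨r • m, ?_⟩
    rw [AdicCompletion.ofTensorProduct_tmul, map_smul]
    ext n
    simp [AdicCompletion.val_smul_apply, AdicCompletion.of_apply]
    rfl

/-- Adic completeness passes to a larger ideal with the same radical. -/
theorem IsAdicComplete.of_pow_le {B : Type*} [CommRing B] {I J : Ideal B} [IsAdicComplete I B]
    [IsHausdorff J B] (hIJ : I ≤ J) {e : ℕ} (he : J ^ e ≤ I) : IsAdicComplete J B where
  prec' f hf := by
    have key : ∀ i : ℕ, J ^ (e * i) ≤ I ^ i := fun i => by
      rw [pow_mul]; exact Ideal.pow_right_mono he i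
    -- Along the indices (e+1)i the terms agree modulo J^(ei) ≤ I^i. The factor is e+1 rather than e
    -- so that n ≤ (e+1)n even for e = 0.
    obtain ⟨L, hL⟩ := IsPrecomplete.prec (I := I) (M := B) inferInstance
      (f := fun i => f ((e + 1) * i)) (fun {i j} hij => by
        have := hf (Nat.mul_le_mul_left (e + 1) hij)
        refine SModEq.mono ?_ this
        simp only [smul_eq_mul, Ideal.mul_top]
        exact (Ideal.pow_le_pow_right (Nat.mul_le_mul_right i e.le_succ)).trans (key i))
    refine ⟨L, fun n => ?_⟩
    have h1 : f n ≡ f ((e + 1) * n) [SMOD (J ^ n • ⊤ : Ideal B)] :=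
      hf (Nat.le_mul_of_pos_left n e.succ_pos)
    refine h1.trans ((hL n).mono ?_)
    simp only [smul_eq_mul, Ideal.mul_top]
    exact Ideal.pow_right_mono hIJ n

/-- A domain that is finite over a complete noetherian local ring is local. -/
theorem IsLocalRing.of_finite_of_isAdicComplete {R B : Type u} [CommRing R] [IsNoetherianRing R]
    [IsLocalRing R] [IsAdicComplete (IsLocalRing.maximalIdeal R) R] [CommRing B] [IsDomain B]
    [Algebra R B] [Module.Finite R B] : IsLocalRing B := by
  set m := IsLocalRing.maximalIdeal R
  set J : Ideal B := m.map (algebraMap R B)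
  have hc : IsAdicComplete m B := IsAdicComplete.of_module_finite m
  have hcJ : IsAdicComplete J B := (IsAdicComplete.map_algebraMap_iff m B).mpr hc
  have hle : ∀ n : Ideal B, n.IsMaximal → J ≤ n := by
    intro n hn
    rw [Ideal.map_le_iff_le_comap]
    have : (n.comap (algebraMap R B)).IsMaximal := Ideal.isMaximal_comap_of_isIntegral_of_isMaximal n
    exact (IsLocalRing.eq_maximalIdeal this).ge
  refine IsLocalRing.of_unique_max_ideal ?_
  obtain ⟨n₁, hn₁⟩ := Ideal.exists_maximal B
  refine ⟨n₁, hn₁, fun n₂ hn₂ => ?_⟩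
  by_contra hne
  obtain ⟨x, hx₁, hx₂⟩ : ∃ x ∈ n₁, x ∉ n₂ := by
    by_contra! h
    exact hne (hn₁.eq_of_le hn₂.ne_top h).symm
  have hart : IsArtinianRing (B ⧸ J) := by
    let : Field (R ⧸ m) := Ideal.Quotient.field m
    let : Algebra (R ⧸ m) (B ⧸ J) := Ideal.Quotient.algebraQuotientOfLEComap Ideal.le_comap_map
    have : IsScalarTower R (R ⧸ m) (B ⧸ J) := IsScalarTower.of_algebraMap_eq fun r => rfl
    have : Module.Finite (R ⧸ m) (B ⧸ J) := Module.Finite.of_restrictScalars_finite R _ _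
    have : IsArtinian (R ⧸ m) (B ⧸ J) := inferInstance
    exact isArtinian_of_tower (R ⧸ m) this
  -- The ideals generated by the powers of x stabilize in the Artinian ring B/J, which makes
  -- x^(n+1)c idempotent modulo J. The exponent is positive, so this element lies in n₁.
  obtain ⟨n, c, hnc⟩ : ∃ n : ℕ, ∃ c : B, x ^ (n + 1) - x ^ (2 * (n + 1)) * c ∈ J := by
    obtain ⟨n, hn⟩ := IsArtinian.range_smul_pow_stabilizes (B ⧸ J) (Ideal.Quotient.mk J x)
    have h3 : (Ideal.Quotient.mk J x) ^ (n + 1) ∈ LinearMap.range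
      ((Ideal.Quotient.mk J x) ^ (n + 1) • LinearMap.id : (B ⧸ J) →ₗ[B ⧸ J] (B ⧸ J)) :=
      ⟨1, by simp⟩
    rw [← hn (n + 1) (by lia), hn (2 * (n + 1)) (by lia)] at h3
    obtain ⟨c, hc⟩ := h3
    obtain ⟨c, rfl⟩ := Ideal.Quotient.mk_surjective c
    refine ⟨n, c, ?_⟩
    rw [← Ideal.Quotient.eq]
    simpa using hc.symm
  set a := x ^ (n + 1) * c with ha
  have ha₁ : a ∈ n₁ := Ideal.mul_mem_right _ _ (Ideal.pow_mem_of_mem _ hx₁ _ n.succ_pos)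
  have ha₂ : a ∉ n₂ := by
    intro h
    have h1 : x ^ (n + 1) ∈ n₂ := by
      have := n₂.add_mem (hle n₂ hn₂ hnc) (n₂.mul_mem_left (x ^ (n + 1)) h)
      convert this using 1
      rw [ha]; ring
    exact hx₂ (hn₂.isPrime.mem_of_pow_mem _ h1)
  have haJ : a ^ 2 - a ∈ J := by
    have := J.mul_mem_left (-c) hnc
    convert this using 1
    rw [ha]; ring
  have hmon : (X ^ 2 - X : B[X]).Monic := by
    have : (X ^ 2 - X : B[X]) = X ^ 2 + (C (-1) * X + C 0) := by simp; ring
    rw [this]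
    refine monic_X_pow_add ?_
    exact (degree_linear_le).trans_lt (by norm_num)
  obtain ⟨e, he, hea⟩ := HenselianRing.is_henselian (I := J) (X ^ 2 - X : B[X]) hmon a
    (by simpa using haJ) (by
      -- The derivative 2a - 1 is its own inverse modulo J, as (2a - 1)² = 1 + 4(a² - a).
      refine IsUnit.of_mul_eq_one (Ideal.Quotient.mk J (2 * a - 1)) ?_
      rw [← map_mul, ← map_one (Ideal.Quotient.mk J), Ideal.Quotient.eq]
      have := J.mul_mem_left 4 haJ
      convert this using 1
      simp; ring)
  have he' : e * (e - 1) = 0 := by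
    have : e ^ 2 - e = 0 := by simpa [IsRoot] using he
    linear_combination this
  -- In a domain the lifted idempotent is 0 or 1: the first puts a in n₂, the second puts 1 in n₁.
  rcases mul_eq_zero.mp he' with h | h
  · refine ha₂ (hle n₂ hn₂ ?_)
    rw [h] at hea
    simpa using hea
  · refine hn₁.ne_top ((Ideal.eq_top_iff_one _).mpr ?_)
    have := n₁.add_mem (hle n₁ hn₁ hea) ha₁
    rw [sub_eq_zero.mp h] at this
    simpa using this

/-- The integral closure of a complete discrete valuation ring in a finite extension of its fraction
field is a complete discrete valuation ring; it has the same residue field if that is algebraically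
closed. -/
theorem IsDiscreteValuationRing.integralClosure_of_isAdicComplete {k : Type v} [Field k]
    [IsAlgClosed k] {R : Type u} [CommRing R] [IsDomain R] [IsDiscreteValuationRing R]
    [IsAdicComplete (IsLocalRing.maximalIdeal R) R] [Algebra R k]
    (hk : Function.Surjective (algebraMap R k)) (K L : Type u) [Field K] [Algebra R K]
    [IsFractionRing R K] [Field L] [Algebra K L] [Algebra R L] [IsScalarTower R K L]
    [FiniteDimensional K L] [Algebra.IsSeparable K L] :
    Module.Finite R (integralClosure R L) ∧
    ∃ _ : IsDiscreteValuationRing (integralClosure R L),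
    IsAdicComplete (IsLocalRing.maximalIdeal (integralClosure R L)) (integralClosure R L) ∧
    ∃ _ : Algebra (integralClosure R L) k, IsScalarTower R (integralClosure R L) k := by
  have hfin : Module.Finite R (integralClosure R L) := IsIntegralClosure.finite R K L _
  have hded : IsDedekindDomain (integralClosure R L) := integralClosure.isDedekindDomain R K L
  have hloc : IsLocalRing (integralClosure R L) := IsLocalRing.of_finite_of_isAdicComplete (R := R)
  have hinj : Function.Injective (algebraMap R (integralClosure R L)) :=
    Function.Injective.of_comp (f := algebraMap (integralClosure R L) L) (by
      rw [← RingHom.coe_comp, ← IsScalarTower.algebraMap_eq, IsScalarTower.algebraMap_eq R K L]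
      exact (algebraMap K L).injective.comp (IsFractionRing.injective R K))
  have hnf : ¬ IsField (integralClosure R L) := fun h =>
    IsDiscreteValuationRing.not_isField R (isField_of_isIntegral_of_isField hinj h)
  have hdvr : IsDiscreteValuationRing (integralClosure R L) :=
    ((IsDiscreteValuationRing.TFAE (integralClosure R L) hnf).out 0 2).mpr hded
  have hJ : (IsLocalRing.maximalIdeal R).map (algebraMap R (integralClosure R L)) ≠ ⊥ := by
    rw [Ne, Ideal.map_eq_bot_iff_of_injective hinj]
    exact IsDiscreteValuationRing.not_a_field R
  have hloc' : IsLocalHom (algebraMap R (integralClosure R L)) :=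
    (algebraMap_isIntegral_iff.mpr inferInstance).isLocalHom hinj
  have hle : (IsLocalRing.maximalIdeal R).map (algebraMap R (integralClosure R L)) ≤
      IsLocalRing.maximalIdeal (integralClosure R L) :=
    ((IsLocalRing.local_hom_TFAE (algebraMap R (integralClosure R L))).out 0 2).mp hloc'
  refine ⟨hfin, hdvr, ?_, ?_⟩
  · have h1 : IsAdicComplete (IsLocalRing.maximalIdeal R) (integralClosure R L) :=
      IsAdicComplete.of_module_finite _
    have h2 := (IsAdicComplete.map_algebraMap_iff (S := integralClosure R L)
      (IsLocalRing.maximalIdeal R) (integralClosure R L)).mpr h1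
    obtain ⟨n, hn⟩ := exists_maximalIdeal_pow_eq_of_principal _ (IsPrincipalIdealRing.principal _) _ hJ
    exact IsAdicComplete.of_pow_le hle hn.ge
  · have hker : ∀ a ∈ IsLocalRing.maximalIdeal R, algebraMap R k a = 0 := by
      have := RingHom.ker_isMaximal_of_surjective _ hk
      exact (IsLocalRing.eq_maximalIdeal this).ge
    let : Algebra (IsLocalRing.ResidueField R) k :=
      (Ideal.Quotient.lift (IsLocalRing.maximalIdeal R) (algebraMap R k) hker).toAlgebra
    -- The residue field of the integral closure is algebraic over that of R, so it maps to k
    -- compatibly.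
    let φ : IsLocalRing.ResidueField (integralClosure R L) →ₐ[IsLocalRing.ResidueField R] k :=
      IsAlgClosed.lift
    let algB : Algebra (integralClosure R L) k :=
      (φ.toRingHom.comp (IsLocalRing.residue _)).toAlgebra
    exact ⟨algB, IsScalarTower.of_algebraMap_eq fun a => (φ.commutes (IsLocalRing.residue R a)).symm⟩

/-! ### Integral closure in quadratic extensions -/

namespace QuadraticAlgebra

/-- The map on quadratic algebras induced by a ring homomorphism. -/
def map {S S' : Type*} [CommRing S] [CommRing S'] (f : S →+* S') {a b : S} {a' b' : S'}
    (ha : f a = a') (hb : f b = b') : QuadraticAlgebra S a b →+* QuadraticAlgebra S' a' b' where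
  toFun z := ⟨f z.re, f z.im⟩
  map_zero' := by ext <;> simp
  map_one' := by ext <;> simp [re_one, im_one]
  map_add' z w := by ext <;> simp
  map_mul' z w := by ext <;> simp [ha, hb]

@[simp]
theorem map_re {S S' : Type*} [CommRing S] [CommRing S'] (f : S →+* S') {a b : S} {a' b' : S'}
    (ha : f a = a') (hb : f b = b') (z : QuadraticAlgebra S a b) : (map f ha hb z).re = f z.re :=
  rfl

@[simp]
theorem map_im {S S' : Type*} [CommRing S] [CommRing S'] (f : S →+* S') {a b : S} {a' b' : S'}
    (ha : f a = a') (hb : f b = b') (z : QuadraticAlgebra S a b) : (map f ha hb z).im = f z.im :=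
  rfl

/-- `S[ω]` with `ω² = a + b ω` satisfies Serre's conditions at every prime element of `S`. -/
def IsNormal (S : Type*) [CommRing S] (a b : S) : Prop :=
  ∀ q : S, Prime q → ∀ u v : S, q ∣ 2 * u + b * v → q ^ 2 ∣ u ^ 2 + b * u * v - a * v ^ 2 → q ∣ v

section Integral

variable {S F : Type*} [CommRing S] [Field F] [Algebra S F] {a b : S}

theorem isIntegral_star {z : QuadraticAlgebra F (algebraMap S F a) (algebraMap S F b)}
    (hz : IsIntegral S z) : IsIntegral S (star z) := by
  let σ : QuadraticAlgebra F (algebraMap S F a) (algebraMap S F b) →ₐ[S]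
      QuadraticAlgebra F (algebraMap S F a) (algebraMap S F b) :=
    { toFun := star
      map_one' := star_one _
      map_mul' x y := by rw [star_mul, mul_comm]
      map_zero' := star_zero _
      map_add' := star_add
      commutes' r := by
        change star (⟨algebraMap S F r, 0⟩ : QuadraticAlgebra F _ _) = ⟨algebraMap S F r, 0⟩
        simp [star_mk] }
  exact hz.map σ

variable [IsDomain S] [UniqueFactorizationMonoid S] [IsFractionRing S F]

theorem exists_trace_of_isIntegral
    {z : QuadraticAlgebra F (algebraMap S F a) (algebraMap S F b)} (hz : IsIntegral S z) :
    ∃ t : S, algebraMap S F t = z.trace := by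
  apply IsIntegrallyClosed.isIntegral_iff.mp
  rw [← isIntegral_algebraMap_iff (B := QuadraticAlgebra F (algebraMap S F a) (algebraMap S F b))
    algebraMap_injective, algebraMap_trace_eq_add_star]
  exact hz.add (isIntegral_star hz)

theorem exists_norm_of_isIntegral
    {z : QuadraticAlgebra F (algebraMap S F a) (algebraMap S F b)} (hz : IsIntegral S z) :
    ∃ t : S, algebraMap S F t = z.norm := by
  apply IsIntegrallyClosed.isIntegral_iff.mp
  rw [← isIntegral_algebraMap_iff (B := QuadraticAlgebra F (algebraMap S F a) (algebraMap S F b))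
    algebraMap_injective, algebraMap_norm_eq_mul_star]
  exact hz.mul (isIntegral_star hz)

/-- Trace and norm of z lie in the integrally closed ring S. Multiplying by q and q² turns this into
the two divisibilities in `IsNormal`, so q ∣ y; the norm then gives q ∣ x² and hence q ∣ x. -/
theorem IsNormal.of_prime_smul (H : IsNormal S a b) {q : S} (hq : Prime q)
    {z : QuadraticAlgebra F (algebraMap S F a) (algebraMap S F b)} (hz : IsIntegral S z)
    {x y : S} (h : q • z = ⟨algebraMap S F x, algebraMap S F y⟩) :
    ∃ x y : S, z = ⟨algebraMap S F x, algebraMap S F y⟩ := by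
  have hq0 : algebraMap S F q ≠ 0 := by
    simpa using hq.ne_zero
  have hre : algebraMap S F q * z.re = algebraMap S F x := by
    have := congrArg re h
    rwa [re_smul, Algebra.smul_def] at this
  have him : algebraMap S F q * z.im = algebraMap S F y := by
    have := congrArg im h
    rwa [im_smul, Algebra.smul_def] at this
  obtain ⟨t, ht⟩ := exists_trace_of_isIntegral hz
  obtain ⟨n, hn⟩ := exists_norm_of_isIntegral hz
  have h1 : 2 * x + b * y = q * t := by
    apply IsFractionRing.injective S F
    push_cast [map_add, map_mul, map_ofNat, ht, ← hre, ← him, trace_def]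
    ring
  have h2 : x ^ 2 + b * x * y - a * y ^ 2 = q ^ 2 * n := by
    apply IsFractionRing.injective S F
    simp only [map_add, map_sub, map_mul, map_pow, hn, ← hre, ← him, norm_def]
    ring
  obtain ⟨y', rfl⟩ := H q hq x y ⟨t, h1⟩ ⟨n, h2⟩
  obtain ⟨x', rfl⟩ : q ∣ x := by
    apply hq.dvd_of_dvd_pow (n := 2)
    exact ⟨q * n - b * x * y' + a * q * y' ^ 2, by linear_combination h2⟩
  refine ⟨x', y', ?_⟩
  ext
  · exact mul_left_cancel₀ hq0 (by rw [hre, map_mul])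
  · exact mul_left_cancel₀ hq0 (by rw [him, map_mul])

/-- A common denominator of the coordinates of z is removed one prime factor at a time. -/
theorem IsNormal.exists_of_isIntegral (H : IsNormal S a b)
    {z : QuadraticAlgebra F (algebraMap S F a) (algebraMap S F b)} (hz : IsIntegral S z) :
    ∃ x y : S, z = ⟨algebraMap S F x, algebraMap S F y⟩ := by
  have key : ∀ d : S, d ≠ 0 →
      ∀ z : QuadraticAlgebra F (algebraMap S F a) (algebraMap S F b), IsIntegral S z →
      (∃ x y : S, d • z = ⟨algebraMap S F x, algebraMap S F y⟩) →
      ∃ x y : S, z = ⟨algebraMap S F x, algebraMap S F y⟩ := by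
    intro d
    induction d using UniqueFactorizationMonoid.induction_on_prime with
    | h₁ => exact fun h => absurd rfl h
    | h₂ d hd =>
      rintro - z - ⟨x, y, h⟩
      obtain ⟨e, he⟩ := hd.exists_left_inv
      refine ⟨e * x, e * y, ?_⟩
      rw [← one_smul S z, ← he, mul_smul, h]
      ext
      · rw [re_smul, Algebra.smul_def, map_mul (algebraMap S F)]
      · rw [im_smul, Algebra.smul_def]
        exact (map_mul (algebraMap S F) e y).symm
    | h₃ d q hd hq ih =>
      rintro - z hz ⟨x, y, h⟩
      refine ih hd z hz ?_
      rw [mul_smul] at h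
      exact H.of_prime_smul hq (hz.smul d) h
  obtain ⟨⟨d, hd⟩, hd'⟩ := IsLocalization.exist_integer_multiples_of_finset (nonZeroDivisors S)
    (by classical exact {z.re, z.im} : Finset F)
  obtain ⟨x, hx⟩ := hd' z.re (by simp)
  obtain ⟨y, hy⟩ := hd' z.im (by simp)
  refine key d (nonZeroDivisors.ne_zero hd) z hz ⟨x, y, ?_⟩
  ext
  · exact hx.symm
  · exact hy.symm

end Integral

end QuadraticAlgebra

/-! ### Charts of the normalization as quadratic algebras -/

/-- A quadratic extension of a field, in terms of any generator. -/
theorem AdjoinRoot.exists_equiv_quadraticAlgebra {F : Type*} [Field F] {p : F[X]} (hp : p.Monic)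
    (hdeg : p.natDegree = 2) {c e : F} (hc : c ≠ 0) {ω : AdjoinRoot p}
    (hω : ω = algebraMap F _ c * AdjoinRoot.root p + algebraMap F _ e) {a b : F}
    (h : ω * ω = algebraMap F _ a + algebraMap F _ b * ω) :
    ∃ φ : QuadraticAlgebra F a b ≃ₐ[F] AdjoinRoot p,
      ∀ z, φ z = algebraMap F _ z.re + algebraMap F _ z.im * ω := by
  let φ : QuadraticAlgebra F a b →ₐ[F] AdjoinRoot p :=
    QuadraticAlgebra.lift ⟨ω, by rw [h, Algebra.smul_def, Algebra.smul_def, mul_one]⟩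
  have hφ : ∀ z, φ z = algebraMap F _ z.re + algebraMap F _ z.im * ω := fun z => by
    simp [φ, Algebra.smul_def]
  refine ⟨AlgEquiv.ofBijective φ ⟨?_, ?_⟩, hφ⟩
  · rw [injective_iff_map_eq_zero]
    intro z hz
    rw [hφ, hω] at hz
    have h1 : AdjoinRoot.mk p (C (z.im * c) * X + C (z.re + z.im * e)) = 0 := by
      rw [← hz]
      simp only [map_add, map_mul, AdjoinRoot.mk_X, AdjoinRoot.mk_C, AdjoinRoot.algebraMap_eq]
      ring
    have h2 : C (z.im * c) * X + C (z.re + z.im * e) = 0 := by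
      by_contra hne
      refine AdjoinRoot.mk_ne_zero_of_natDegree_lt hp hne ?_ h1
      rw [hdeg]
      exact natDegree_linear_le.trans_lt (by norm_num)
    have h3 : z.im * c = 0 := by simpa using congrArg (coeff · 1) h2
    have h4 : z.im = 0 := (mul_eq_zero.mp h3).resolve_right hc
    have h5 : z.re = 0 := by simpa [h4] using congrArg (coeff · 0) h2
    exact QuadraticAlgebra.ext h5 h4
  · rw [← AlgHom.range_eq_top, eq_top_iff, ← AdjoinRoot.adjoinRoot_eq_top, Algebra.adjoin_le_iff,
      Set.singleton_subset_iff]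
    refine ⟨⟨- c⁻¹ * e, c⁻¹⟩, ?_⟩
    change φ _ = _
    rw [hφ, hω]
    simp only [map_mul, map_neg]
    have : algebraMap F (AdjoinRoot p) c⁻¹ * algebraMap F (AdjoinRoot p) c = 1 := by
      rw [← map_mul, inv_mul_cancel₀ hc, map_one]
    linear_combination AdjoinRoot.root p * this

namespace DoubleCover

/-- This replaces the subalgebra R[s] of K(T) by an abstract ring S with the same image; S will be a
polynomial ring, where unique factorization is available. -/
theorem mem_chart_iff {R K : Type*} [CommRing R] [Field K] [Algebra R K] (S : Type*) [CommRing S]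
    [Algebra R S] [Algebra S (RatFunc K)] [IsScalarTower R S (RatFunc K)] {s : Set (RatFunc K)}
    (hs : (IsScalarTower.toAlgHom R S (RatFunc K)).range = Algebra.adjoin R s)
    {p : (RatFunc K)[X]} {z : AdjoinRoot p} : z ∈ chart R p s ↔ IsIntegral S z := by
  have hmem : ∀ x : S, algebraMap S (RatFunc K) x ∈ Algebra.adjoin R s := fun x => by
    rw [← hs]
    exact ⟨x, rfl⟩
  let : Algebra S (Algebra.adjoin R s) :=
    ((algebraMap S (RatFunc K)).codRestrict (Algebra.adjoin R s) hmem).toAlgebra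
  have : IsScalarTower S (Algebra.adjoin R s) (RatFunc K) :=
    IsScalarTower.of_algebraMap_eq fun x => rfl
  have : IsScalarTower S (Algebra.adjoin R s) (AdjoinRoot p) :=
    IsScalarTower.of_algebraMap_eq fun x => rfl
  have hsurj : Function.Surjective (algebraMap S (Algebra.adjoin R s)) := by
    rintro ⟨y, hy⟩
    rw [← hs] at hy
    obtain ⟨x, hx⟩ := hy
    exact ⟨x, Subtype.ext hx⟩
  have : Algebra.IsIntegral S (Algebra.adjoin R s) :=
    Algebra.isIntegral_def.mpr fun y => by
      obtain ⟨x, rfl⟩ := hsurj y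
      exact isIntegral_algebraMap
  exact ⟨fun h => isIntegral_trans z h, fun h => IsIntegral.tower_top h⟩

theorem exists_equiv_chart {R K : Type*} [CommRing R] [Field K] [Algebra R K] (S : Type*)
    [CommRing S] [IsDomain S] [UniqueFactorizationMonoid S] [Algebra R S] [Algebra S (RatFunc K)]
    [IsScalarTower R S (RatFunc K)] [IsFractionRing S (RatFunc K)] {s : Set (RatFunc K)}
    (hs : (IsScalarTower.toAlgHom R S (RatFunc K)).range = Algebra.adjoin R s)
    {p : (RatFunc K)[X]} (hp : p.Monic) (hdeg : p.natDegree = 2) {c e : RatFunc K} (hc : c ≠ 0)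
    {ω : AdjoinRoot p}
    (hω : ω = algebraMap (RatFunc K) _ c * AdjoinRoot.root p + algebraMap (RatFunc K) _ e) {a b : S}
    (h : ω * ω = algebraMap (RatFunc K) _ (algebraMap S _ a) +
      algebraMap (RatFunc K) _ (algebraMap S _ b) * ω) (H : QuadraticAlgebra.IsNormal S a b) :
    ∃ φ : QuadraticAlgebra S a b ≃ₐ[R] chart R p s, ∀ z, (φ z : AdjoinRoot p) =
      algebraMap (RatFunc K) _ (algebraMap S _ z.re) +
        algebraMap (RatFunc K) _ (algebraMap S _ z.im) * ω := by
  obtain ⟨Φ, hΦ⟩ := AdjoinRoot.exists_equiv_quadraticAlgebra hp hdeg hc hω h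
  have hωint : IsIntegral S ω := by
    refine ⟨X ^ 2 - (C b * X + C a), monic_X_pow_sub (degree_linear_le.trans_lt (by norm_num)), ?_⟩
    simp only [eval₂_sub, eval₂_add, eval₂_mul, eval₂_X_pow, eval₂_C, eval₂_X]
    rw [IsScalarTower.algebraMap_eq S (RatFunc K) (AdjoinRoot p)]
    simp only [RingHom.comp_apply]
    linear_combination h
  let φ : QuadraticAlgebra S a b →ₐ[S] AdjoinRoot p :=
    QuadraticAlgebra.lift ⟨ω, by
      rw [h, Algebra.smul_def, Algebra.smul_def, mul_one,
        IsScalarTower.algebraMap_apply S (RatFunc K) (AdjoinRoot p),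
        IsScalarTower.algebraMap_apply S (RatFunc K) (AdjoinRoot p)]⟩
  have hφ : ∀ z, φ z = algebraMap (RatFunc K) _ (algebraMap S _ z.re) +
        algebraMap (RatFunc K) _ (algebraMap S _ z.im) * ω := fun z => by
    simp [φ, Algebra.smul_def, IsScalarTower.algebraMap_apply S (RatFunc K) (AdjoinRoot p)]
  have hφΦ : ∀ z, φ z = Φ ⟨algebraMap S _ z.re, algebraMap S _ z.im⟩ := fun z => by rw [hφ, hΦ]
  have hinj : Function.Injective (φ.restrictScalars R) := by
    intro z w hzw
    have := Φ.injective (((hφΦ z).symm.trans hzw).trans (hφΦ w))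
    rw [QuadraticAlgebra.ext_iff] at this
    exact QuadraticAlgebra.ext (IsFractionRing.injective S (RatFunc K) this.1)
      (IsFractionRing.injective S (RatFunc K) this.2)
  have hrange : (φ.restrictScalars R).range = chart R p s := by
    ext z
    rw [mem_chart_iff S hs]
    constructor
    · rintro ⟨w, rfl⟩
      change IsIntegral S (φ w)
      rw [hφ, ← IsScalarTower.algebraMap_apply, ← IsScalarTower.algebraMap_apply]
      exact isIntegral_algebraMap.add (isIntegral_algebraMap.mul hωint)
    · intro hz
      obtain ⟨x, y, hxy⟩ := H.exists_of_isIntegral (F := RatFunc K)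
        (hz.map (Φ.symm.toAlgHom.restrictScalars S))
      refine ⟨⟨x, y⟩, ?_⟩
      change φ _ = _
      rw [hφΦ, ← Φ.apply_symm_apply z]
      exact congrArg Φ hxy.symm
  refine ⟨(AlgEquiv.ofInjective _ hinj).trans (Subalgebra.equivOfEq _ _ hrange), fun z => hφ z⟩

end DoubleCover
namespace DoubleCover

/-- Coordinates on the projective line. -/
structure IsCoordinate {K : Type*} [Field K] (θ : RatFunc K) : Prop where
  injective : Function.Injective (aeval θ : K[X] →ₐ[K] RatFunc K)
  exists_div : ∀ z, ∃ p q : K[X], z = aeval θ p / aeval θ q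

theorem isCoordinate_X {K : Type*} [Field K] : IsCoordinate (RatFunc.X : RatFunc K) where
  injective p q h := by
    rw [RatFunc.aeval_X_left_eq_algebraMap, RatFunc.aeval_X_left_eq_algebraMap] at h
    exact RatFunc.algebraMap_injective K h
  exists_div z := ⟨z.num, z.denom, by
    rw [RatFunc.aeval_X_left_eq_algebraMap, RatFunc.aeval_X_left_eq_algebraMap,
      RatFunc.num_div_denom]⟩

/-- Reversing coefficients gives p(θ) = θ^deg(p) · p.reverse(θ⁻¹). Treating T and T⁻¹ alike lets one
construction serve both charts. -/
theorem IsCoordinate.inv {K : Type*} [Field K] {θ : RatFunc K} (h : IsCoordinate θ) :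
    IsCoordinate θ⁻¹ := by
  have h0 : θ ≠ 0 := by
    rintro rfl
    exact X_ne_zero (h.injective (a₁ := (X : K[X])) (a₂ := 0) (by simp))
  have key : ∀ p : K[X], aeval θ⁻¹ p.reverse * θ ^ p.natDegree = aeval θ p := fun p => by
    let := invertibleOfNonzero h0
    have := eval₂_reverse_mul_pow (algebraMap K (RatFunc K)) θ p
    rwa [invOf_eq_inv] at this
  have key' : ∀ p : K[X], aeval θ p.reverse * θ⁻¹ ^ p.natDegree = aeval θ⁻¹ p := fun p => by
    let := invertibleOfNonzero (inv_ne_zero h0)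
    have := eval₂_reverse_mul_pow (algebraMap K (RatFunc K)) θ⁻¹ p
    rwa [invOf_eq_inv, inv_inv] at this
  constructor
  · rw [injective_iff_map_eq_zero]
    intro p hp
    rw [← key'] at hp
    have := (mul_eq_zero.mp hp).resolve_right (pow_ne_zero _ (inv_ne_zero h0))
    have h2 := h.injective (this.trans (map_zero (aeval (R := K) θ)).symm)
    simpa using h2
  · intro z
    obtain ⟨p, q, rfl⟩ := h.exists_div z
    refine ⟨p.reverse * X ^ q.natDegree, q.reverse * X ^ p.natDegree, ?_⟩
    rw [← key, ← key]
    simp only [map_mul, map_pow, aeval_X]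
    generalize aeval θ⁻¹ p.reverse = y
    generalize aeval θ⁻¹ q.reverse = z
    by_cases hz : z = 0
    · simp [hz]
    · have e (n : ℕ) : θ ^ n * θ⁻¹ ^ n = 1 := by rw [← mul_pow, mul_inv_cancel₀ h0, one_pow]
      rw [div_eq_div_iff (mul_ne_zero hz (pow_ne_zero _ h0))
        (mul_ne_zero hz (pow_ne_zero _ (inv_ne_zero h0)))]
      linear_combination y * z * (e p.natDegree - e q.natDegree)

section

variable {R K : Type*} [CommRing R] [Field K] [Algebra R K] [IsFractionRing R K]

theorem IsCoordinate.injective_aeval {θ : RatFunc K} (h : IsCoordinate θ) :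
    Function.Injective (aeval θ : R[X] →ₐ[R] RatFunc K) := by
  intro p q hpq
  rw [← aeval_map_algebraMap K θ p, ← aeval_map_algebraMap K θ q] at hpq
  exact map_injective _ (IsFractionRing.injective R K) (h.injective hpq)

theorem IsCoordinate.isFractionRing [IsDomain R] {θ : RatFunc K} (h : IsCoordinate θ) :
    letI := (aeval (R := R) θ).toAlgebra
    IsFractionRing R[X] (RatFunc K) := by
  let := (aeval (R := R) θ).toAlgebra
  have : FaithfulSMul R[X] (RatFunc K) :=
    (faithfulSMul_iff_algebraMap_injective _ _).mpr h.injective_aeval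
  refine IsFractionRing.of_field _ _ fun z => ?_
  change ∃ x y, z = aeval θ x / aeval θ y
  obtain ⟨p, q, rfl⟩ := h.exists_div z
  have key : ∀ p : K[X], ∃ p' : R[X], ∃ b : R, b ≠ 0 ∧
      aeval θ p' = algebraMap R (RatFunc K) b * aeval θ p := fun p => by
    obtain ⟨b, hb0, hb⟩ := IsLocalization.integerNormalization_spec (nonZeroDivisors R) p
    refine ⟨IsLocalization.integerNormalization (nonZeroDivisors R) p, b,
      nonZeroDivisors.ne_zero hb0, ?_⟩
    rw [← aeval_map_algebraMap K, hb, ← IsScalarTower.algebraMap_smul K, map_smul, Algebra.smul_def,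
      IsScalarTower.algebraMap_apply R K (RatFunc K)]
  have hne : ∀ b : R, b ≠ 0 → algebraMap R (RatFunc K) b ≠ 0 := fun b hb => by
    rw [IsScalarTower.algebraMap_apply R K (RatFunc K)]
    simpa using hb
  obtain ⟨p', b, hb, hp⟩ := key p
  obtain ⟨q', c, hc, hq⟩ := key q
  refine ⟨p' * C c, q' * C b, ?_⟩
  have := hne b hb
  have := hne c hc
  simp only [map_mul, hp, hq, aeval_C]
  by_cases hq0 : aeval θ q = 0
  · simp [hq0]
  · field_simp

/-- The chart above `Spec R[θ]` for a cover given by a quadratic equation over `R[θ]`. -/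
theorem exists_equiv_chart_singleton [IsDomain R] [UniqueFactorizationMonoid R] {θ : RatFunc K}
    (hθ : IsCoordinate θ) {p : (RatFunc K)[X]} (hp : p.Monic) (hdeg : p.natDegree = 2)
    {c e : RatFunc K} (hc : c ≠ 0) {ω : AdjoinRoot p}
    (hω : ω = algebraMap (RatFunc K) _ c * AdjoinRoot.root p + algebraMap (RatFunc K) _ e)
    {a b : R[X]} (h : ω * ω = algebraMap (RatFunc K) _ (aeval θ a) +
      algebraMap (RatFunc K) _ (aeval θ b) * ω) (H : QuadraticAlgebra.IsNormal R[X] a b) :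
    ∃ φ : QuadraticAlgebra R[X] a b ≃ₐ[R] chart R p {θ}, ∀ z, (φ z : AdjoinRoot p) =
      algebraMap (RatFunc K) _ (aeval θ z.re) + algebraMap (RatFunc K) _ (aeval θ z.im) * ω := by
  let := (aeval (R := R) θ).toAlgebra
  have := hθ.isFractionRing (R := R)
  have : IsScalarTower R R[X] (RatFunc K) := IsScalarTower.of_algHom (aeval (R := R) θ)
  refine exists_equiv_chart R[X] ?_ hp hdeg hc hω h H
  rw [Algebra.adjoin_singleton_eq_range_aeval]
  ext z
  rfl

end

end DoubleCover

/-! ### Maps out of plane curves and the Jacobian criterion -/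

namespace QuadraticAlgebra

section

variable {R B : Type*} [CommRing R] [CommRing B] [Algebra R B] {a b : R[X]}

/-- Homomorphisms out of `R[x, ω]`. -/
theorem exists_algHom_of_polynomial {x z : B} (h : z * z = aeval x a + aeval x b * z) :
    ∃ φ : QuadraticAlgebra R[X] a b →ₐ[R] B, ∀ w, φ w = aeval x w.re + aeval x w.im * z := by
  let := (aeval (R := R) x).toAlgebra
  have : IsScalarTower R R[X] B := IsScalarTower.of_algHom (aeval (R := R) x)
  have hsmul : ∀ (p : R[X]) (y : B), p • y = aeval x p * y := fun p y => Algebra.smul_def p y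
  let φ : QuadraticAlgebra R[X] a b →ₐ[R[X]] B :=
    lift ⟨z, by rw [h, hsmul, hsmul, mul_one]⟩
  refine ⟨φ.restrictScalars R, fun w => ?_⟩
  change φ w = _
  simp [φ, hsmul]

theorem apply_eq_of_polynomial (φ : QuadraticAlgebra R[X] a b →ₐ[R] B)
    (w : QuadraticAlgebra R[X] a b) :
    φ w = aeval (φ ⟨X, 0⟩) w.re + aeval (φ ⟨X, 0⟩) w.im * φ ω := by
  have hC : ∀ p : R[X], φ ⟨p, 0⟩ = aeval (φ ⟨X, 0⟩) p := fun p => by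
    have : φ.comp (IsScalarTower.toAlgHom R R[X] (QuadraticAlgebra R[X] a b)) =
        aeval (φ ⟨X, 0⟩) := by
      ext
      rw [aeval_X]
      rfl
    exact DFunLike.congr_fun this p
  rw [← hC, ← hC, ← map_mul, ← map_add]
  congr 1
  ext <;> simp

theorem algHom_ext_of_polynomial {φ ψ : QuadraticAlgebra R[X] a b →ₐ[R] B}
    (hX : φ ⟨X, 0⟩ = ψ ⟨X, 0⟩) (hω : φ ω = ψ ω) : φ = ψ := by
  ext w
  rw [apply_eq_of_polynomial φ, apply_eq_of_polynomial ψ, hX, hω]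

end

/-- The Jacobian criterion for the plane curve `z² = a(x) + b(x) z`. -/
theorem smooth_of_polynomial {R : Type*} [CommRing R] [IsNoetherianRing R] {a b : R[X]}
    {u v : QuadraticAlgebra R[X] a b}
    (h : u * (2 * ω - ⟨b, 0⟩) + v * (⟨derivative a, 0⟩ + ⟨derivative b, 0⟩ * ω) = 1) :
    Algebra.Smooth R (QuadraticAlgebra R[X] a b) where
  finitePresentation := by
    have : Algebra.FiniteType R[X] (QuadraticAlgebra R[X] a b) := inferInstance
    exact Algebra.FinitePresentation.of_finiteType.mp
      (Algebra.FiniteType.trans (S := R[X]) inferInstance this)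
  formallySmooth := by
    rw [Algebra.FormallySmooth.iff_comp_surjective]
    intro B _ _ I hI g
    obtain ⟨x, hx⟩ := Ideal.Quotient.mk_surjective (I := I) (g ⟨X, 0⟩)
    obtain ⟨z, hz⟩ := Ideal.Quotient.mk_surjective (I := I) (g ω)
    obtain ⟨s, hs⟩ := Ideal.Quotient.mk_surjective (I := I) (g u)
    obtain ⟨t, ht⟩ := Ideal.Quotient.mk_surjective (I := I) (g v)
    have hpoly : ∀ p : R[X], Ideal.Quotient.mk I (aeval x p) = g ⟨p, 0⟩ := fun p => by
      have h1 := apply_eq_of_polynomial g ⟨p, 0⟩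
      rw [map_zero, zero_mul, add_zero, ← hx] at h1
      rw [h1]
      exact (aeval_algHom_apply (Ideal.Quotient.mkₐ R I) x p).symm
    have hε : z ^ 2 - aeval x a - aeval x b * z ∈ I := by
      rw [← Ideal.Quotient.eq_zero_iff_mem, map_sub, map_sub, map_mul, map_pow, hpoly, hpoly, hz,
        ← map_mul, ← map_pow, ← map_sub, ← map_sub, ← map_zero g]
      congr 1
      ext <;> simp [pow_two]
    have hj : s * (2 * z - aeval x b) + t * (aeval x (derivative a) + aeval x (derivative b) * z) - 1
        ∈ I := by
      rw [← Ideal.Quotient.eq_zero_iff_mem]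
      simp only [map_sub, map_add, map_mul, map_one, map_ofNat, hpoly, hz, hs, ht]
      have := congrArg g h
      simp only [map_sub, map_add, map_mul, map_one, map_ofNat] at this
      rw [this, sub_self]
    set ε := z ^ 2 - aeval x a - aeval x b * z with hεdef
    have hI2 : ∀ i ∈ I, ∀ j ∈ I, i * j = 0 := fun i hi j hj => by
      have : i * j ∈ I ^ 2 := by
        rw [pow_two]
        exact Ideal.mul_mem_mul hi hj
      rwa [hI] at this
    have hεε := hI2 ε hε ε hε
    have hεj := hI2 ε hε _ hj
    have hsq : (ε * t) ^ 2 = 0 := by linear_combination t ^ 2 * hεε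
    -- One Newton step: with F = z² - a(x) - b(x)z and F(x, z) = ε, moving (x, z) by (εt, -εs)
    -- changes F by -ε times the Jacobian combination, which is 1 modulo I. All further terms vanish
    -- since I² = 0.
    obtain ⟨φ, hφ⟩ := exists_algHom_of_polynomial (a := a) (b := b) (x := x + ε * t) (z := z - ε * s)
      (by
        rw [aeval_add_of_sq_eq_zero _ _ _ hsq, aeval_add_of_sq_eq_zero _ _ _ hsq]
        linear_combination (s ^ 2 + aeval x (derivative b) * t * s) * hεε - hεj - hεdef)
    refine ⟨φ, algHom_ext_of_polynomial ?_ ?_⟩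
    · change Ideal.Quotient.mk I (φ _) = _
      rw [hφ, ← hx, Ideal.Quotient.eq]
      simpa using I.mul_mem_right t hε
    · change Ideal.Quotient.mk I (φ _) = _
      rw [hφ, ← hz, Ideal.Quotient.eq]
      simpa using I.mul_mem_right s hε

end QuadraticAlgebra

/-! ### Special fibres and the overlap of the charts -/

/-- The special fibre of an algebra, in terms of a surjection whose kernel is generated by a
uniformizer. -/
theorem Algebra.TensorProduct.exists_algEquiv_of_surjective {R k M N : Type*} [CommRing R]
    [CommRing k] [Algebra R k] (hk : Function.Surjective (algebraMap R k)) {π : R}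
    (hπ : algebraMap R k π = 0) [CommRing M] [Algebra R M] [CommRing N] [Algebra k N]
    (ψ : M →+* N) (hψ : ∀ r, ψ (algebraMap R M r) = algebraMap k N (algebraMap R k r))
    (hsurj : Function.Surjective ψ) (hker : ∀ m, ψ m = 0 → ∃ m', m = algebraMap R M π * m') :
    ∃ e : (k ⊗[R] M) ≃ₐ[k] N, ∀ m, e (1 ⊗ₜ m) = ψ m := by
  let : Algebra R N := ((algebraMap k N).comp (algebraMap R k)).toAlgebra
  have : IsScalarTower R k N := IsScalarTower.of_algebraMap_eq fun r => rfl
  let ψ' : M →ₐ[R] N := { ψ with commutes' := hψ }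
  let f : (k ⊗[R] M) →ₐ[k] N :=
    Algebra.TensorProduct.lift (Algebra.ofId k N) ψ' fun _ _ => Commute.all _ _
  have hf : ∀ m, f (1 ⊗ₜ m) = ψ m := fun m => by
    simp only [f, Algebra.TensorProduct.lift_tmul, map_one, one_mul]
    rfl
  -- As R → k is onto, every tensor is pure with first factor 1.
  have hone : ∀ t : k ⊗[R] M, ∃ m, t = 1 ⊗ₜ m := fun t => by
    induction t with
    | zero => exact ⟨0, (tmul_zero _ _).symm⟩
    | add s t hs ht =>
      obtain ⟨m, rfl⟩ := hs
      obtain ⟨n, rfl⟩ := ht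
      exact ⟨m + n, (tmul_add _ _ _).symm⟩
    | tmul c m =>
      obtain ⟨r, rfl⟩ := hk c
      exact ⟨r • m, by
        rw [tmul_smul, smul_tmul', Algebra.smul_def, mul_one]⟩
  refine ⟨AlgEquiv.ofBijective f ⟨?_, fun n => ?_⟩, hf⟩
  · rw [injective_iff_map_eq_zero]
    intro t ht
    obtain ⟨m, rfl⟩ := hone t
    rw [hf] at ht
    obtain ⟨m', rfl⟩ := hker m ht
    rw [← Algebra.smul_def, tmul_smul, smul_tmul', Algebra.smul_def, hπ, zero_mul, zero_tmul]
  · obtain ⟨m, rfl⟩ := hsurj n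
    exact ⟨1 ⊗ₜ m, hf m⟩

/-- A subalgebra obtained by inverting an element of a smaller one. -/
theorem Subalgebra.isLocalization_away {R L : Type*} [CommRing R] [CommRing L] [Algebra R L]
    {A B : Subalgebra R L} (h : A ≤ B) (x : A) {y : L} (hy : y ∈ B) (hxy : (x : L) * y = 1)
    (hsurj : ∀ z ∈ B, ∃ n : ℕ, (x : L) ^ n * z ∈ A) :
    letI := (Subalgebra.inclusion h).toRingHom.toAlgebra
    IsLocalization.Away x B := by
  let := (Subalgebra.inclusion h).toRingHom.toAlgebra
  have hu : algebraMap A B x * ⟨y, hy⟩ = 1 := Subtype.ext hxy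
  refine IsLocalization.Away.mk x ?_ ?_ ?_
  · exact IsUnit.of_mul_eq_one _ hu
  · intro z
    obtain ⟨n, hn⟩ := hsurj z z.2
    exact ⟨n, ⟨_, hn⟩, Subtype.ext (mul_comm _ _)⟩
  · intro a b hab
    refine ⟨0, ?_⟩
    rw [Subalgebra.inclusion_injective h hab]

/-- Integral closure commutes with inverting x. This is what makes the overlap chart a localization
of the chart at infinity. -/
theorem IsIntegral.exists_pow_mul_of_subalgebra {R F L : Type*} [CommRing R] [CommRing F]
    [CommRing L] [Algebra R F] [Algebra F L] {A B : Subalgebra R F} {z : L} (hz : IsIntegral B z)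
    (h : A ≤ B) {x y : F} (hx : x ∈ A) (hy : y ∈ B) (hxy : x * y = 1)
    (hsurj : ∀ z ∈ B, ∃ n : ℕ, x ^ n * z ∈ A) :
    ∃ n : ℕ, IsIntegral A (algebraMap F L x ^ n * z) := by
  let := (Subalgebra.inclusion h).toRingHom.toAlgebra
  have := Subalgebra.isLocalization_away h ⟨x, hx⟩ hy hxy hsurj
  have : IsScalarTower A B L := IsScalarTower.of_algebraMap_eq fun x => rfl
  obtain ⟨⟨_, n, rfl⟩, hn⟩ :=
    IsIntegral.exists_multiple_integral_of_isLocalization (Submonoid.powers (⟨x, hx⟩ : A)) z hz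
  have hx' : algebraMap A L ⟨x, hx⟩ = algebraMap F L x := rfl
  rw [Submonoid.smul_def, Algebra.smul_def, map_pow, hx'] at hn
  exact ⟨n, hn⟩

namespace QuadraticAlgebra

theorem ringHom_ext_of_polynomial {R B : Type*} [CommRing R] [CommRing B] {a b : R[X]}
    {φ ψ : QuadraticAlgebra R[X] a b →+* B} (hC : ∀ r, φ ⟨C r, 0⟩ = ψ ⟨C r, 0⟩)
    (hX : φ ⟨X, 0⟩ = ψ ⟨X, 0⟩) (hω : φ ω = ψ ω) : φ = ψ := by
  let : Algebra R B := (φ.comp (algebraMap R (QuadraticAlgebra R[X] a b))).toAlgebra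
  let φ' : QuadraticAlgebra R[X] a b →ₐ[R] B := { φ with commutes' := fun r => rfl }
  let ψ' : QuadraticAlgebra R[X] a b →ₐ[R] B := { ψ with commutes' := fun r => (hC r).symm }
  have : φ' = ψ' := algHom_ext_of_polynomial hX hω
  ext z
  exact DFunLike.congr_fun this z

theorem map_surjective {R k : Type*} [CommRing R] [CommRing k] {f : R →+* k}
    (hf : Function.Surjective f) {a b : R[X]} {a' b' : k[X]} (ha : mapRingHom f a = a')
    (hb : mapRingHom f b = b') : Function.Surjective (map (mapRingHom f) ha hb) := fun z => by
  obtain ⟨x, hx⟩ := Polynomial.map_surjective f hf z.re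
  obtain ⟨y, hy⟩ := Polynomial.map_surjective f hf z.im
  exact ⟨⟨x, y⟩, QuadraticAlgebra.ext hx hy⟩

theorem exists_of_map_eq_zero {R k : Type*} [CommRing R] [CommRing k] {f : R →+* k} {π : R}
    (hπ : ∀ r, f r = 0 → π ∣ r) {a b : R[X]} {a' b' : k[X]} (ha : mapRingHom f a = a')
    (hb : mapRingHom f b = b') (z : QuadraticAlgebra R[X] a b)
    (hz : map (mapRingHom f) ha hb z = 0) :
    ∃ w, z = algebraMap R (QuadraticAlgebra R[X] a b) π * w := by
  have key : ∀ p : R[X], mapRingHom f p = 0 → ∃ q, p = C π * q := fun p hp => by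
    refine C_dvd_iff_dvd_coeff _ _ |>.mpr fun i => hπ _ ?_
    simpa using congrArg (coeff · i) hp
  obtain ⟨x, hx⟩ := key z.re (congrArg re hz)
  obtain ⟨y, hy⟩ := key z.im (congrArg im hz)
  refine ⟨⟨x, y⟩, ?_⟩
  rw [← Algebra.smul_def]
  ext1
  · rw [hx, re_smul, smul_eq_C_mul]
  · rw [hy, im_smul, smul_eq_C_mul]

end QuadraticAlgebra

namespace DoubleCover

theorem exists_pow_mul_mem_adjoin {R K : Type*} [CommRing R] [Field K] [Algebra R K]
    {z : RatFunc K} (hz : z ∈ Algebra.adjoin R (overlap K)) :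
    ∃ n : ℕ, RatFunc.X⁻¹ ^ n * z ∈ Algebra.adjoin R (nearInfty K) := by
  have hx : RatFunc.X⁻¹ ∈ Algebra.adjoin R (nearInfty K) :=
    Algebra.subset_adjoin (Set.mem_singleton _)
  induction hz using Algebra.adjoin_induction with
  | mem z hz =>
    rcases hz with rfl | rfl
    · exact ⟨1, by simp [RatFunc.X_ne_zero]⟩
    · exact ⟨0, by simp [hx]⟩
  | algebraMap r => exact ⟨0, by simp⟩
  | add z w _ _ hz hw =>
    obtain ⟨m, hm⟩ := hz
    obtain ⟨n, hn⟩ := hw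
    refine ⟨m + n, ?_⟩
    have := add_mem (mul_mem (pow_mem hx n) hm) (mul_mem (pow_mem hx m) hn)
    convert this using 1
    ring
  | mul z w _ _ hz hw =>
    obtain ⟨m, hm⟩ := hz
    obtain ⟨n, hn⟩ := hw
    refine ⟨m + n, ?_⟩
    convert mul_mem hm hn using 1
    ring

theorem mem_chart_iff_isIntegral {R K : Type*} [CommRing R] [Field K] [Algebra R K]
    {p : (RatFunc K)[X]} {s : Set (RatFunc K)} {z : AdjoinRoot p} :
    z ∈ chart R p s ↔ IsIntegral (Algebra.adjoin R s) z :=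
  Iff.rfl

theorem exists_pow_mul_mem_chart {R K : Type*} [CommRing R] [Field K] [Algebra R K]
    {p : (RatFunc K)[X]} {z : AdjoinRoot p} (hz : z ∈ chart R p (overlap K)) :
    ∃ n : ℕ, algebraMap (RatFunc K) (AdjoinRoot p) RatFunc.X⁻¹ ^ n * z ∈
      chart R p (nearInfty K) := by
  rw [mem_chart_iff_isIntegral] at hz
  simp_rw [mem_chart_iff_isIntegral]
  exact hz.exists_pow_mul_of_subalgebra (Algebra.adjoin_mono (by simp))
    (Algebra.subset_adjoin (Set.mem_singleton _)) (y := RatFunc.X) (Algebra.subset_adjoin (by simp))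
    (inv_mul_cancel₀ RatFunc.X_ne_zero) fun z hz => exists_pow_mul_mem_adjoin hz

/-- The overlap therefore needs no equation of its own: a reduction map there is obtained from the
one at infinity by the universal property. -/
theorem isLocalization_overlap {R K : Type*} [CommRing R] [Field K] [Algebra R K]
    (p : (RatFunc K)[X]) :
    letI := (res R p (s := nearInfty K) (s' := overlap K) (by simp)).toRingHom.toAlgebra
    IsLocalization.Away (coord R p (Set.mem_singleton (RatFunc.X⁻¹ : RatFunc K)))
      (chart R p (overlap K)) :=
  Subalgebra.isLocalization_away _ _ (y := algebraMap _ _ RatFunc.X)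
    (algebraMap_mem_chart p (by simp))
    (by
      change algebraMap _ _ _ * _ = _
      rw [← map_mul, inv_mul_cancel₀ RatFunc.X_ne_zero, map_one])
    fun _ hz => exists_pow_mul_mem_chart hz

section

variable {R K k : Type*} [CommRing R] [Field K] [Algebra R K] [Field k]
  {p : (RatFunc K)[X]} {q : (RatFunc k)[X]}

/-- A reduction of functions above a chart at infinity extends to the overlap. -/
theorem exists_overlap_ringHom (ψ : chart R p (nearInfty K) →+* chart k q (nearInfty k))
    (hx : ψ (coord R p (Set.mem_singleton RatFunc.X⁻¹)) =
      coord k q (Set.mem_singleton RatFunc.X⁻¹)) :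
    ∃ ψ' : chart R p (overlap K) →+* chart k q (overlap k),
      ∀ z, ψ' (res R p (by simp) z) = res k q (by simp) (ψ z) := by
  let := (res R p (s := nearInfty K) (s' := overlap K) (by simp)).toRingHom.toAlgebra
  have := isLocalization_overlap (R := R) p
  let g : chart R p (nearInfty K) →+* chart k q (overlap k) :=
    (res k q (s := nearInfty k) (s' := overlap k) (by simp)).toRingHom.comp ψ
  have hg : IsUnit (g (coord R p (Set.mem_singleton RatFunc.X⁻¹))) := by
    let := (res k q (s := nearInfty k) (s' := overlap k) (by simp)).toRingHom.toAlgebra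
    have := isLocalization_overlap (R := k) q
    have h := IsLocalization.Away.algebraMap_isUnit (S := chart k q (overlap k))
      (coord k q (Set.mem_singleton (RatFunc.X⁻¹ : RatFunc k)))
    rw [← hx] at h
    exact h
  exact ⟨IsLocalization.Away.lift _ hg, fun z => IsLocalization.Away.lift_eq _ hg z⟩

end

/-- The reduction of a quadratic algebra over a polynomial ring. -/
theorem exists_reduction {R k A A' : Type*} [CommRing R] [CommRing k] [Algebra R k]
    (hk : Function.Surjective (algebraMap R k)) {π : R} (hπ : ∀ r, algebraMap R k r = 0 → π ∣ r)
    [CommRing A] [Algebra R A] [CommRing A'] [Algebra k A'] {a b : R[X]} {a' b' : k[X]}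
    (ha : mapRingHom (algebraMap R k) a = a') (hb : mapRingHom (algebraMap R k) b = b')
    (φ : QuadraticAlgebra R[X] a b ≃ₐ[R] A) (φ' : QuadraticAlgebra k[X] a' b' ≃ₐ[k] A') :
    ∃ ψ : A →+* A', (∀ z, ψ (φ z) = φ' (QuadraticAlgebra.map _ ha hb z)) ∧
      (∀ r, ψ (algebraMap R A r) = algebraMap k A' (algebraMap R k r)) ∧
      Function.Surjective ψ ∧ ∀ m, ψ m = 0 → ∃ m', m = algebraMap R A π * m' := by
  let ψ : A →+* A' := (φ' : QuadraticAlgebra k[X] a' b' →+* A').comp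
    ((QuadraticAlgebra.map _ ha hb).comp (φ.symm : A →+* QuadraticAlgebra R[X] a b))
  have h : ∀ m, ψ m = φ' (QuadraticAlgebra.map _ ha hb (φ.symm m)) := fun m => rfl
  refine ⟨ψ, fun z => ?_, fun r => ?_, fun m => ?_, fun m hm => ?_⟩
  · rw [h, φ.symm_apply_apply]
  · rw [h, φ.symm.commutes, ← φ'.commutes]
    congr 1
    change (⟨mapRingHom _ (C r), mapRingHom _ 0⟩ : QuadraticAlgebra k[X] a' b') = ⟨C _, 0⟩
    simp
  · obtain ⟨z, hz⟩ := QuadraticAlgebra.map_surjective hk ha hb (φ'.symm m)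
    exact ⟨φ z, by rw [h, φ.symm_apply_apply, hz, φ'.apply_symm_apply]⟩
  · rw [h, EmbeddingLike.map_eq_zero_iff] at hm
    obtain ⟨w, hw⟩ := QuadraticAlgebra.exists_of_map_eq_zero hπ ha hb _ hm
    refine ⟨φ w, ?_⟩
    rw [← φ.commutes, ← map_mul, ← hw, φ.apply_symm_apply]

section

variable {R K k : Type*} [CommRing R] [Field K] [Algebra R K] [Field k] [Algebra R k]
  {p : (RatFunc K)[X]} {q : (RatFunc k)[X]}

theorem coe_res (p : (RatFunc K)[X]) {s s' : Set (RatFunc K)} (h : s ⊆ s') (z : chart R p s) :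
    (res R p h z : AdjoinRoot p) = z :=
  Subalgebra.coe_inclusion (chart_mono p h) z

theorem coe_coord (p : (RatFunc K)[X]) {s : Set (RatFunc K)} {x : RatFunc K} (hx : x ∈ s) :
    (coord R p hx : AdjoinRoot p) = algebraMap (RatFunc K) (AdjoinRoot p) x :=
  rfl

theorem res_coord (p : (RatFunc K)[X]) {s s' : Set (RatFunc K)} (h : s ⊆ s') {x : RatFunc K}
    (hx : x ∈ s) : res R p h (coord R p hx) = coord R p (h hx) :=
  Subtype.ext (coe_res p h _)

theorem coord_inv_mul_coord (p : (RatFunc K)[X]) :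
    coord R p (show RatFunc.X⁻¹ ∈ overlap K by simp) *
      coord R p (show RatFunc.X ∈ overlap K by simp) = 1 := by
  apply Subtype.ext
  change algebraMap _ _ _ * algebraMap _ _ _ = 1
  rw [← map_mul, inv_mul_cancel₀ RatFunc.X_ne_zero, map_one]

theorem exists_res_eq (z : chart R p (overlap K)) :
    ∃ (n : ℕ) (w : chart R p (nearInfty K)),
      z = coord R p (show RatFunc.X ∈ overlap K by simp) ^ n * res R p (by simp) w := by
  obtain ⟨n, hn⟩ := exists_pow_mul_mem_chart z.2
  refine ⟨n, ⟨_, hn⟩, ?_⟩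
  have h : res R p (by simp) ⟨_, hn⟩ =
      coord R p (show RatFunc.X⁻¹ ∈ overlap K by simp) ^ n * z := rfl
  rw [h, ← mul_assoc, ← mul_pow, mul_comm (coord R p _), coord_inv_mul_coord, one_pow, one_mul]

/-- A reduction of functions above a chart at infinity extends to the overlap. -/
theorem exists_overlap_reduction {π : R}
    (ψ : chart R p (nearInfty K) →+* chart k q (nearInfty k))
    (hx : ψ (coord R p (Set.mem_singleton RatFunc.X⁻¹)) =
      coord k q (Set.mem_singleton RatFunc.X⁻¹))
    (hr : ∀ r, ψ (algebraMap R _ r) = algebraMap k _ (algebraMap R k r))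
    (hsurj : Function.Surjective ψ) (hker : ∀ m, ψ m = 0 → ∃ m', m = algebraMap R _ π * m') :
    ∃ ψ' : chart R p (overlap K) →+* chart k q (overlap k),
      (∀ z, ψ' (res R p (by simp) z) = res k q (by simp) (ψ z)) ∧
      ψ' (coord R p (show RatFunc.X ∈ overlap K by simp)) = coord k q (show RatFunc.X ∈ overlap k by simp) ∧
      (∀ r, ψ' (algebraMap R _ r) = algebraMap k _ (algebraMap R k r)) ∧
      Function.Surjective ψ' ∧ ∀ m, ψ' m = 0 → ∃ m', m = algebraMap R _ π * m' := by
  obtain ⟨ψ', h⟩ := exists_overlap_ringHom ψ hx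
  have hxinv : ψ' (coord R p (show RatFunc.X⁻¹ ∈ overlap K by simp)) =
      coord k q (show RatFunc.X⁻¹ ∈ overlap k by simp) := by
    have := h (coord R p (Set.mem_singleton RatFunc.X⁻¹))
    rw [hx] at this
    exact this
  have hX : ψ' (coord R p (show RatFunc.X ∈ overlap K by simp)) = coord k q (show RatFunc.X ∈ overlap k by simp) := by
    have h1 := congrArg ψ' (coord_inv_mul_coord (R := R) p)
    rw [map_mul, map_one, hxinv] at h1
    have h2 := coord_inv_mul_coord (R := k) q
    linear_combination coord k q (show RatFunc.X ∈ overlap k by simp) * h1 -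
      ψ' (coord R p (show RatFunc.X ∈ overlap K by simp)) * h2
  refine ⟨ψ', h, hX, fun r => ?_, fun z => ?_, fun z hz => ?_⟩
  · have := h (algebraMap R _ r)
    rw [hr, AlgHom.commutes, AlgHom.commutes] at this
    exact this
  · obtain ⟨n, w, rfl⟩ := exists_res_eq z
    obtain ⟨w, rfl⟩ := hsurj w
    exact ⟨coord R p (show RatFunc.X ∈ overlap K by simp) ^ n * res R p (by simp) w, by
      rw [map_mul, map_pow, h, hX]⟩
  · obtain ⟨n, w, rfl⟩ := exists_res_eq z
    rw [map_mul, map_pow, h, hX] at hz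
    have hw : res k q (s := nearInfty k) (s' := overlap k) (by simp) (ψ w) = 0 := by
      have h2 : coord k q (show RatFunc.X⁻¹ ∈ overlap k by simp) ^ n *
          coord k q (show RatFunc.X ∈ overlap k by simp) ^ n = 1 := by
        rw [← mul_pow, coord_inv_mul_coord, one_pow]
      linear_combination coord k q (show RatFunc.X⁻¹ ∈ overlap k by simp) ^ n * hz -
        res k q (by simp) (ψ w) * h2
    obtain ⟨w', rfl⟩ := hker w ((map_eq_zero_iff _ (Subalgebra.inclusion_injective _)).mp hw)
    refine ⟨coord R p (show RatFunc.X ∈ overlap K by simp) ^ n * res R p (by simp) w', ?_⟩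
    rw [map_mul, AlgHom.commutes]
    ring

/-- The special fibre of a double cover, in terms of equations for it on the two standard charts. -/
theorem HasSpecialFibre.of_charts (hk : Function.Surjective (algebraMap R k)) {π : R}
    (hπ₀ : algebraMap R k π = 0) (hπ : ∀ r, algebraMap R k r = 0 → π ∣ r)
    {a₀ b₀ a₁ b₁ : R[X]} {a₀' b₀' a₁' b₁' : k[X]}
    (ha₀ : mapRingHom (algebraMap R k) a₀ = a₀') (hb₀ : mapRingHom (algebraMap R k) b₀ = b₀')
    (ha₁ : mapRingHom (algebraMap R k) a₁ = a₁') (hb₁ : mapRingHom (algebraMap R k) b₁ = b₁')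
    {ω₀ ω₁ : AdjoinRoot p} (hω : ω₁ = algebraMap (RatFunc K) _ RatFunc.X⁻¹ ^ 2 * ω₀)
    {η₀ η₁ : AdjoinRoot q} (hη : η₁ = algebraMap (RatFunc k) _ RatFunc.X⁻¹ ^ 2 * η₀)
    (φ₀ : QuadraticAlgebra R[X] a₀ b₀ ≃ₐ[R] chart R p (nearZero K))
    (hφ₀ : ∀ z, (φ₀ z : AdjoinRoot p) = algebraMap (RatFunc K) _ (aeval RatFunc.X z.re) +
      algebraMap (RatFunc K) _ (aeval RatFunc.X z.im) * ω₀)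
    (φ₁ : QuadraticAlgebra R[X] a₁ b₁ ≃ₐ[R] chart R p (nearInfty K))
    (hφ₁ : ∀ z, (φ₁ z : AdjoinRoot p) = algebraMap (RatFunc K) _ (aeval RatFunc.X⁻¹ z.re) +
      algebraMap (RatFunc K) _ (aeval RatFunc.X⁻¹ z.im) * ω₁)
    (φ₀' : QuadraticAlgebra k[X] a₀' b₀' ≃ₐ[k] chart k q (nearZero k))
    (hφ₀' : ∀ z, (φ₀' z : AdjoinRoot q) = algebraMap (RatFunc k) _ (aeval RatFunc.X z.re) +
      algebraMap (RatFunc k) _ (aeval RatFunc.X z.im) * η₀)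
    (φ₁' : QuadraticAlgebra k[X] a₁' b₁' ≃ₐ[k] chart k q (nearInfty k))
    (hφ₁' : ∀ z, (φ₁' z : AdjoinRoot q) = algebraMap (RatFunc k) _ (aeval RatFunc.X⁻¹ z.re) +
      algebraMap (RatFunc k) _ (aeval RatFunc.X⁻¹ z.im) * η₁) :
    HasSpecialFibre R p q := by
  obtain ⟨ψ₀, hψ₀, hr₀, hs₀, hker₀⟩ := exists_reduction hk hπ ha₀ hb₀ φ₀ φ₀'
  obtain ⟨ψ₁, hψ₁, hr₁, hs₁, hker₁⟩ := exists_reduction hk hπ ha₁ hb₁ φ₁ φ₁'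
  have hX₀ : φ₀ ⟨X, 0⟩ = coord R p (Set.mem_singleton RatFunc.X) :=
    Subtype.ext (by rw [hφ₀]; simp [coord])
  have hX₁ : φ₁ ⟨X, 0⟩ = coord R p (Set.mem_singleton RatFunc.X⁻¹) :=
    Subtype.ext (by rw [hφ₁]; simp [coord])
  have hX₀' : φ₀' ⟨X, 0⟩ = coord k q (Set.mem_singleton RatFunc.X) :=
    Subtype.ext (by rw [hφ₀']; simp [coord])
  have hX₁' : φ₁' ⟨X, 0⟩ = coord k q (Set.mem_singleton RatFunc.X⁻¹) :=
    Subtype.ext (by rw [hφ₁']; simp [coord])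
  have hc₀ : ψ₀ (coord R p (Set.mem_singleton RatFunc.X)) =
      coord k q (Set.mem_singleton RatFunc.X) := by
    rw [← hX₀, hψ₀, ← hX₀']
    congr 1
    ext1 <;> simp
  have hc₁ : ψ₁ (coord R p (Set.mem_singleton RatFunc.X⁻¹)) =
      coord k q (Set.mem_singleton RatFunc.X⁻¹) := by
    rw [← hX₁, hψ₁, ← hX₁']
    congr 1
    ext1 <;> simp
  obtain ⟨ψ₂, hψ₂, hc₂, hr₂, hs₂, hker₂⟩ := exists_overlap_reduction ψ₁ hc₁ hr₁ hs₁ hker₁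
  have hψ₂₀ : ∀ z : chart R p (nearZero K),
      ψ₂ (res R p (by simp) z) = res k q (by simp) (ψ₀ z) := by
    -- The map ψ₂ was built from the chart at infinity, so agreement with ψ₀ must be checked, on the
    -- generators: constants, T and ω₀. For ω₀ it follows from ω₁ = T⁻²ω₀, because T is invertible
    -- on the overlap.
    have key : (ψ₂.comp (res R p (s := nearZero K) (s' := overlap K) (by simp)).toRingHom).comp
          (φ₀ : QuadraticAlgebra R[X] a₀ b₀ →+* chart R p (nearZero K)) =
        ((res k q (s := nearZero k) (s' := overlap k) (by simp)).toRingHom.comp ψ₀).comp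
          (φ₀ : QuadraticAlgebra R[X] a₀ b₀ →+* chart R p (nearZero K)) := by
      apply QuadraticAlgebra.ringHom_ext_of_polynomial
      · intro r
        have h1 : φ₀ ⟨C r, 0⟩ = algebraMap R _ r := φ₀.commutes r
        change ψ₂ (res R p (s' := overlap K) (by simp) (φ₀ ⟨C r, 0⟩)) = res k q (s' := overlap k) (by simp) (ψ₀ (φ₀ ⟨C r, 0⟩))
        rw [h1, AlgHom.commutes, hr₂, hr₀, AlgHom.commutes]
      · change ψ₂ (res R p (s' := overlap K) (by simp) (φ₀ ⟨X, 0⟩)) = res k q (s' := overlap k) (by simp) (ψ₀ (φ₀ ⟨X, 0⟩))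
        rw [hX₀, hc₀, res_coord, res_coord]
        exact hc₂
      · change ψ₂ (res R p (s' := overlap K) (by simp) (φ₀ QuadraticAlgebra.omega)) =
          res k q (s' := overlap k) (by simp) (ψ₀ (φ₀ QuadraticAlgebra.omega))
        have h1 : res R p (s' := overlap K) (by simp) (φ₁ QuadraticAlgebra.omega) =
            res R p (by simp) (coord R p (Set.mem_singleton RatFunc.X⁻¹)) ^ 2 *
              res R p (by simp) (φ₀ QuadraticAlgebra.omega) := by
          apply Subtype.ext
          rw [MulMemClass.coe_mul, SubmonoidClass.coe_pow, coe_res, coe_res, coe_res, coe_coord,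
            hφ₀, hφ₁]
          simp [hω]
        have h2 : res k q (s' := overlap k) (by simp) (φ₁' QuadraticAlgebra.omega) =
            res k q (by simp) (coord k q (Set.mem_singleton RatFunc.X⁻¹)) ^ 2 *
              res k q (by simp) (φ₀' QuadraticAlgebra.omega) := by
          apply Subtype.ext
          rw [MulMemClass.coe_mul, SubmonoidClass.coe_pow, coe_res, coe_res, coe_res, coe_coord,
            hφ₀', hφ₁']
          simp [hη]
        have hm₁ : QuadraticAlgebra.map _ ha₁ hb₁ QuadraticAlgebra.omega =
          QuadraticAlgebra.omega := by ext1 <;> simp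
        have hm₀ : QuadraticAlgebra.map _ ha₀ hb₀ QuadraticAlgebra.omega =
          QuadraticAlgebra.omega := by ext1 <;> simp
        have h3 := congrArg ψ₂ h1
        rw [map_mul, map_pow, hψ₂, hψ₂, hψ₁, hm₁, hc₁, h2] at h3
        have h4 : res k q (s' := overlap k) (by simp) (coord k q (Set.mem_singleton RatFunc.X⁻¹)) *
            coord k q (show RatFunc.X ∈ overlap k by simp) = 1 := by
          rw [res_coord]
          exact coord_inv_mul_coord q
        rw [hψ₀, hm₀]
        have h5 := congrArg (· ^ 2) h4
        simp only [mul_pow, one_pow] at h5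
        linear_combination (-coord k q (show RatFunc.X ∈ overlap k by simp) ^ 2) * h3 +
          (res k q (by simp) (φ₀' QuadraticAlgebra.omega) -
            ψ₂ (res R p (by simp) (φ₀ QuadraticAlgebra.omega))) * h5
    intro z
    have := RingHom.congr_fun key (φ₀.symm z)
    simpa using this
  obtain ⟨e₀, he₀⟩ :=
    Algebra.TensorProduct.exists_algEquiv_of_surjective hk hπ₀ ψ₀ hr₀ hs₀ hker₀
  obtain ⟨e₁, he₁⟩ :=
    Algebra.TensorProduct.exists_algEquiv_of_surjective hk hπ₀ ψ₁ hr₁ hs₁ hker₁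
  obtain ⟨e₂, he₂⟩ :=
    Algebra.TensorProduct.exists_algEquiv_of_surjective hk hπ₀ ψ₂ hr₂ hs₂ hker₂
  refine ⟨e₀, e₁, e₂, fun z => ?_, fun z => ?_, ?_, ?_⟩
  · rw [he₂, he₀, hψ₂₀]
  · rw [he₂, he₁, hψ₂]
  · rw [he₀, hc₀]
  · rw [he₁, hc₁]

end

end DoubleCover

/-! ### Normality of the two affine equations -/

theorem Prime.pow_two_dvd_mul {S : Type*} [CommRing S] [IsDomain S] {q x y : S} (hq : Prime q)
    (h : q ^ 2 ∣ x * y) : q ^ 2 ∣ x ∨ q ^ 2 ∣ y ∨ q ∣ x ∧ q ∣ y := by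
  by_cases hx : q ∣ x
  · by_cases hy : q ∣ y
    · exact Or.inr (Or.inr ⟨hx, hy⟩)
    · exact Or.inl (hq.pow_dvd_of_dvd_mul_right 2 hy h)
  · exact Or.inr (Or.inl (hq.pow_dvd_of_dvd_mul_left 2 hx h))

namespace DoubleCover

section

variable {A : Type*} [CommRing A]

/-- The right-hand side of the equation `z² = βx + c₂x² + c₃x³ - (1 + dx) z`. -/
def inftyConst (β c₂ c₃ : A) : A[X] := C β * X + C c₂ * X ^ 2 + C c₃ * X ^ 3

/-- The linear coefficient of the equation `z² = βx + c₂x² + c₃x³ - (1 + dx) z`. -/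
def inftyLin (d : A) : A[X] := -(1 + C d * X)

/-- The right-hand side of the equation `y² = c₃t + c₂t² + βt³ - (t² + dt) y`. -/
def zeroConst (β c₂ c₃ : A) : A[X] := C c₃ * X + C c₂ * X ^ 2 + C β * X ^ 3

/-- The linear coefficient of the equation `y² = c₃t + c₂t² + βt³ - (t² + dt) y`. -/
def zeroLin (d : A) : A[X] := -(X ^ 2 + C d * X)

/-- The discriminant `(1 + dx)² + 4(βx + c₂x² + c₃x³)` factors as `(1 - e₁x)(1 - e₂x)(1 - e₃x)`,
and `e₁`, `e₂`, `e₃` and their differences divide powers of `2`. -/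
structure IsSplit (d β c₂ c₃ e₁ e₂ e₃ : A) : Prop where
  ne_zero : c₃ ≠ 0
  -- Used as: every prime dividing 2 divides d. Plain divisibility 2 ∣ d would fail in the
  -- application, where d is σ² times a unit.
  two_dvd : ∃ n, 2 ∣ d ^ n
  coeff_one : -(e₁ + e₂ + e₃) = 2 * d + 4 * β
  coeff_two : e₁ * e₂ + e₁ * e₃ + e₂ * e₃ = d ^ 2 + 4 * c₂
  coeff_three : -(e₁ * e₂ * e₃) = 4 * c₃
  dvd₁ : e₁ ∣ 2 ^ 2
  dvd₂ : e₂ ∣ 2 ^ 2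
  dvd₃ : e₃ ∣ 2 ^ 2
  dvd₁₂ : e₁ - e₂ ∣ 2 ^ 2
  dvd₁₃ : e₁ - e₃ ∣ 2 ^ 2
  dvd₂₃ : e₂ - e₃ ∣ 2 ^ 2

variable [IsDomain A] {d β c₂ c₃ e₁ e₂ e₃ : A}

/-- If q ∣ 2, then q ∣ d, so q is prime to 1 + dX and the trace condition forces q ∣ v. Otherwise
(trace)² - 4·norm = v²·disc shows that q ∤ v would give q² ∣ (1 - e₁X)(1 - e₂X)(1 - e₃X). But each
factor is squarefree at q, and two of them sharing q would make q divide some eᵢ - eⱼ, a divisor of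
4. -/
theorem IsSplit.isNormal_infty (h : IsSplit d β c₂ c₃ e₁ e₂ e₃) :
    QuadraticAlgebra.IsNormal A[X] (inftyConst β c₂ c₃) (inftyLin d) := by
  intro q hq u v hu huv
  by_contra hv
  have hunit : ¬ q ∣ 1 := fun h => hq.not_isUnit (isUnit_of_dvd_one h)
  by_cases h2 : q ∣ 2
  · obtain ⟨n, hn⟩ := h.two_dvd
    have hd : q ∣ C d := by
      apply hq.dvd_of_dvd_pow (n := n)
      rw [← C_pow]
      exact h2.trans (by simpa only [map_pow, map_ofNat] using map_dvd (C : A →+* A[X]) hn)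
    have h3 : q ∣ inftyLin d * v := by
      have := dvd_sub hu (h2.mul_right u)
      rwa [add_sub_cancel_left] at this
    have h4 := (hq.dvd_or_dvd h3).resolve_right hv
    have h5 := dvd_add h4 (hd.mul_right X)
    apply hunit
    rw [← dvd_neg]
    convert h5 using 1
    rw [inftyLin]
    ring
  · have hC : ∀ e : A, e ∣ 2 ^ 2 → ¬ q ∣ C e := fun e he hqe => h2 <| by
      apply hq.dvd_of_dvd_pow (n := 2)
      exact hqe.trans (by simpa only [map_pow, map_ofNat] using map_dvd (C : A →+* A[X]) he)
    have hlin : ∀ e : A, e ∣ 2 ^ 2 → ¬ q ^ 2 ∣ 1 - C e * X := fun e he hqe => hC e he <| by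
      have := pow_sub_one_dvd_derivative_of_pow_dvd hqe
      simpa using this
    have htwo : ∀ e e' : A, e - e' ∣ 2 ^ 2 → q ∣ 1 - C e * X → q ∣ 1 - C e' * X → False :=
      fun e e' he hqe hqe' => hC _ he <| by
        have := dvd_sub (hqe'.mul_left (C e)) (hqe.mul_left (C e'))
        convert this using 1
        rw [C_sub]
        ring
    have hdisc : q ^ 2 ∣ ((1 - C e₁ * X) * (1 - C e₂ * X) * (1 - C e₃ * X)) := by
      have h3 : q ^ 2 ∣ v ^ 2 * ((1 - C e₁ * X) * (1 - C e₂ * X) * (1 - C e₃ * X)) := by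
        have h4 := dvd_sub (pow_dvd_pow_of_dvd hu 2) (huv.mul_left 4)
        convert h4 using 1
        have i₁ := congrArg C h.coeff_one
        have i₂ := congrArg C h.coeff_two
        have i₃ := congrArg C h.coeff_three
        simp only [map_neg, map_add, map_mul, map_pow, map_ofNat] at i₁ i₂ i₃
        rw [inftyConst, inftyLin]
        linear_combination v ^ 2 * X * i₁ + v ^ 2 * X ^ 2 * i₂ + v ^ 2 * X ^ 3 * i₃
      refine hq.pow_dvd_of_dvd_mul_left 2 (fun h => hv (hq.dvd_of_dvd_pow h)) h3
    rcases hq.pow_two_dvd_mul hdisc with h3 | h3 | ⟨h3, h4⟩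
    · rcases hq.pow_two_dvd_mul h3 with h3 | h3 | ⟨h3, h4⟩
      · exact hlin _ h.dvd₁ h3
      · exact hlin _ h.dvd₂ h3
      · exact htwo _ _ h.dvd₁₂ h3 h4
    · exact hlin _ h.dvd₃ h3
    · rcases hq.dvd_or_dvd h3 with h3 | h3
      · exact htwo _ _ h.dvd₁₃ h3 h4
      · exact htwo _ _ h.dvd₂₃ h3 h4

/-- The discriminant is now X(X - e₁)(X - e₂)(X - e₃), and primes other than X are treated as at
infinity. At X the argument is Eisenstein's: the constant term is divisible by X exactly once
because c₃ ≠ 0. -/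
theorem IsSplit.isNormal_zero (h : IsSplit d β c₂ c₃ e₁ e₂ e₃) :
    QuadraticAlgebra.IsNormal A[X] (zeroConst β c₂ c₃) (zeroLin d) := by
  intro q hq u v hu huv
  by_contra hv
  have hunit : ¬ q ∣ 1 := fun h => hq.not_isUnit (isUnit_of_dvd_one h)
  by_cases hqX : q ∣ X
  · have hass : Associated q X := hq.associated_of_dvd prime_X hqX
    have hXv : ¬ X ∣ v := fun h => hv (hqX.trans h)
    have h1 : X ^ 2 ∣ u ^ 2 + zeroLin d * u * v - zeroConst β c₂ c₃ * v ^ 2 :=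
      (hass.pow_pow (n := 2)).symm.dvd.trans huv
    obtain ⟨w, hw⟩ := h1
    obtain ⟨u', rfl⟩ : X ∣ u := by
      apply prime_X.dvd_of_dvd_pow (n := 2)
      refine ⟨X * w + (X + C d) * u * v + (C c₃ + C c₂ * X + C β * X ^ 2) * v ^ 2, ?_⟩
      rw [zeroConst, zeroLin] at hw
      linear_combination hw
    have h2 : X ∣ C c₃ * v ^ 2 := by
      refine ⟨u' ^ 2 - (X + C d) * u' * v - (C c₂ + C β * X) * v ^ 2 - w, ?_⟩
      apply mul_left_cancel₀ (X_ne_zero (R := A))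
      rw [zeroConst, zeroLin] at hw
      linear_combination -hw
    rcases prime_X.dvd_or_dvd h2 with h3 | h3
    · rw [X_dvd_iff, coeff_C_zero] at h3
      exact h.ne_zero h3
    · exact hXv (prime_X.dvd_of_dvd_pow h3)
  by_cases h2 : q ∣ 2
  · obtain ⟨n, hn⟩ := h.two_dvd
    have hd : q ∣ C d := by
      apply hq.dvd_of_dvd_pow (n := n)
      rw [← C_pow]
      exact h2.trans (by simpa only [map_pow, map_ofNat] using map_dvd (C : A →+* A[X]) hn)
    have h3 : q ∣ zeroLin d * v := by
      have := dvd_sub hu (h2.mul_right u)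
      rwa [add_sub_cancel_left] at this
    have h4 := (hq.dvd_or_dvd h3).resolve_right hv
    have h5 := dvd_add h4 (hd.mul_right X)
    apply hqX
    apply hq.dvd_of_dvd_pow (n := 2)
    rw [← dvd_neg]
    convert h5 using 1
    rw [zeroLin]
    ring
  · have hC : ∀ e : A, e ∣ 2 ^ 2 → ¬ q ∣ C e := fun e he hqe => h2 <| by
      apply hq.dvd_of_dvd_pow (n := 2)
      exact hqe.trans (by simpa only [map_pow, map_ofNat] using map_dvd (C : A →+* A[X]) he)
    have hlin : ∀ e : A, ¬ q ^ 2 ∣ X - C e := fun e hqe => hunit <| by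
      have := pow_sub_one_dvd_derivative_of_pow_dvd hqe
      simpa using this
    have htwo : ∀ e e' : A, e - e' ∣ 2 ^ 2 → q ∣ X - C e → q ∣ X - C e' → False :=
      fun e e' he hqe hqe' => hC _ he <| by
        have := dvd_sub hqe' hqe
        convert this using 1
        rw [C_sub]
        ring
    have hdisc : q ^ 2 ∣ ((X - C e₁) * (X - C e₂) * (X - C e₃)) := by
      have h3 : q ^ 2 ∣ v ^ 2 * (X * ((X - C e₁) * (X - C e₂) * (X - C e₃))) := by
        have h4 := dvd_sub (pow_dvd_pow_of_dvd hu 2) (huv.mul_left 4)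
        convert h4 using 1
        have i₁ := congrArg C h.coeff_one
        have i₂ := congrArg C h.coeff_two
        have i₃ := congrArg C h.coeff_three
        simp only [map_neg, map_add, map_mul, map_pow, map_ofNat] at i₁ i₂ i₃
        rw [zeroConst, zeroLin]
        linear_combination v ^ 2 * X ^ 3 * i₁ + v ^ 2 * X ^ 2 * i₂ + v ^ 2 * X * i₃
      exact hq.pow_dvd_of_dvd_mul_left 2 hqX
        (hq.pow_dvd_of_dvd_mul_left 2 (fun h => hv (hq.dvd_of_dvd_pow h)) h3)
    rcases hq.pow_two_dvd_mul hdisc with h3 | h3 | ⟨h3, h4⟩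
    · rcases hq.pow_two_dvd_mul h3 with h3 | h3 | ⟨h3, h4⟩
      · exact hlin _ h3
      · exact hlin _ h3
      · exact htwo _ _ h.dvd₁₂ h3 h4
    · exact hlin _ h3
    · rcases hq.dvd_or_dvd h3 with h3 | h3
      · exact htwo _ _ h.dvd₁₃ h3 h4
      · exact htwo _ _ h.dvd₂₃ h3 h4

end

/-! ### Smoothness from the Weierstrass discriminant -/

section Smooth

/-- The curve `z² + (1 + dx) z = βx + c₂x² + c₃x³` in Weierstrass form. -/
def weierstrass {A : Type*} [CommRing A] (d β c₂ c₃ : A) : WeierstrassCurve A :=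
  ⟨d, c₂, c₃, β * c₃, 0⟩

/-- Multiplying the equation by c₃² and scaling both coordinates by c₃ gives Weierstrass form, where
Δ ≠ 0 excludes singular points. -/
theorem false_of_singular_infty {L : Type*} [Field L] {d β c₂ c₃ x z : L}
    (hΔ : (weierstrass d β c₂ c₃).Δ ≠ 0)
    (h : z ^ 2 + (1 + d * x) * z = β * x + c₂ * x ^ 2 + c₃ * x ^ 3)
    (hz : 2 * z + (1 + d * x) = 0) (hx : β + 2 * c₂ * x + 3 * c₃ * x ^ 2 - d * z = 0) : False := by
  have h1 : (weierstrass d β c₂ c₃).toAffine.Equation (c₃ * x) (c₃ * z) := by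
    rw [WeierstrassCurve.Affine.equation_iff]
    simp only [weierstrass]
    linear_combination c₃ ^ 2 * h
  rw [WeierstrassCurve.Affine.equation_iff_nonsingular_of_Δ_ne_zero hΔ,
    WeierstrassCurve.Affine.nonsingular_iff] at h1
  simp only [weierstrass] at h1
  rcases h1.2 with h2 | h2
  · apply h2
    linear_combination -c₃ * hx
  · apply h2
    linear_combination c₃ * hz

/-- For t ≠ 0 the point (t⁻¹, y/t²) would be singular on the other chart. For t = 0 also y = 0, and
the derivative in t is c₃. -/
theorem false_of_singular_zero {L : Type*} [Field L] {d β c₂ c₃ t y : L} (hc : c₃ ≠ 0)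
    (hΔ : (weierstrass d β c₂ c₃).Δ ≠ 0)
    (h : y ^ 2 + (t ^ 2 + d * t) * y = c₃ * t + c₂ * t ^ 2 + β * t ^ 3)
    (hy : 2 * y + (t ^ 2 + d * t) = 0)
    (ht : c₃ + 2 * c₂ * t + 3 * β * t ^ 2 - (2 * t + d) * y = 0) : False := by
  by_cases h0 : t = 0
  · subst h0
    have hy0 : y = 0 := by
      apply pow_eq_zero_iff (two_ne_zero) |>.mp
      linear_combination h
    subst hy0
    exact hc (by linear_combination ht)
  · refine false_of_singular_infty (x := t⁻¹) (z := y / t ^ 2) hΔ ?_ ?_ ?_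
    · field_simp
      linear_combination h
    · field_simp
      linear_combination hy
    · field_simp
      apply mul_left_cancel₀ h0
      linear_combination -4 * h - t * ht + 2 * y * hy

/-- If the two partial derivatives generated a proper ideal, a maximal ideal above it would give a
singular point over its residue field. -/
theorem exists_jacobian_of_forall {R : Type u} [CommRing R] {a b : R[X]}
    (h : ∀ (L : Type u) [Field L] [Algebra R L] (x z : L), z ^ 2 = aeval x a + aeval x b * z →
      2 * z = aeval x b → aeval x (derivative a) + aeval x (derivative b) * z = 0 → False) :
    ∃ u v : QuadraticAlgebra R[X] a b, u * (2 * QuadraticAlgebra.omega - ⟨b, 0⟩) +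
      v * (⟨derivative a, 0⟩ + ⟨derivative b, 0⟩ * QuadraticAlgebra.omega) = 1 := by
  rw [← Ideal.mem_span_pair, ← Ideal.eq_top_iff_one]
  by_contra hne
  obtain ⟨P, hP, hle⟩ := Ideal.exists_le_maximal _ hne
  let : Field (QuadraticAlgebra R[X] a b ⧸ P) := Ideal.Quotient.field P
  have hpoly : ∀ p : R[X], Ideal.Quotient.mkₐ R P ⟨p, 0⟩ =
      aeval (Ideal.Quotient.mkₐ R P ⟨X, 0⟩) p := fun p => by
    rw [QuadraticAlgebra.apply_eq_of_polynomial]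
    simp
  refine h (QuadraticAlgebra R[X] a b ⧸ P) (Ideal.Quotient.mkₐ R P ⟨X, 0⟩)
    (Ideal.Quotient.mkₐ R P QuadraticAlgebra.omega) ?_ ?_ ?_
  · rw [← hpoly, ← hpoly, ← map_mul, ← map_pow, ← map_add]
    congr 1
    ext <;> simp [pow_two]
  · have h1 : Ideal.Quotient.mkₐ R P (2 * QuadraticAlgebra.omega - ⟨b, 0⟩) = 0 :=
      Ideal.Quotient.eq_zero_iff_mem.mpr (hle (Ideal.subset_span (by simp)))
    rw [map_sub, map_mul, map_ofNat, sub_eq_zero] at h1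
    rw [h1, hpoly]
  · have h1 : Ideal.Quotient.mkₐ R P
        (⟨derivative a, 0⟩ + ⟨derivative b, 0⟩ * QuadraticAlgebra.omega) = 0 :=
      Ideal.Quotient.eq_zero_iff_mem.mpr (hle (Ideal.subset_span (by simp)))
    rwa [map_add, map_mul, hpoly (derivative a), hpoly (derivative b)] at h1

variable {R : Type*} [CommRing R] {d β c₂ c₃ : R}

theorem map_Δ_weierstrass_ne_zero (hΔ : IsUnit (weierstrass d β c₂ c₃).Δ) (L : Type*) [Field L]
    [Algebra R L] : (weierstrass (algebraMap R L d) (algebraMap R L β) (algebraMap R L c₂)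
      (algebraMap R L c₃)).Δ ≠ 0 := by
  have h1 : weierstrass (algebraMap R L d) (algebraMap R L β) (algebraMap R L c₂)
      (algebraMap R L c₃) = (weierstrass d β c₂ c₃).map (algebraMap R L) := by
    simp [weierstrass, WeierstrassCurve.map]
  rw [h1, WeierstrassCurve.map_Δ]
  exact (hΔ.map (algebraMap R L)).ne_zero

theorem smooth_infty [IsNoetherianRing R] (hΔ : IsUnit (weierstrass d β c₂ c₃).Δ) :
    Algebra.Smooth R (QuadraticAlgebra R[X] (inftyConst β c₂ c₃) (inftyLin d)) := by
  obtain ⟨u, v, h⟩ := exists_jacobian_of_forall (a := inftyConst β c₂ c₃) (b := inftyLin d)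
    fun L _ _ x z h₁ h₂ h₃ => by
      simp only [inftyConst, inftyLin, map_add, map_neg, map_mul, map_pow, map_one, aeval_C,
        aeval_X, derivative_mul, derivative_X_pow, derivative_C,
        derivative_X, derivative_one, map_zero, map_natCast] at h₁ h₂ h₃
      push_cast at h₃
      refine false_of_singular_infty (map_Δ_weierstrass_ne_zero hΔ L) (x := x) (z := z) ?_ ?_ ?_
      · linear_combination h₁
      · linear_combination h₂
      · simp at h₃
        linear_combination h₃
  exact QuadraticAlgebra.smooth_of_polynomial h

theorem smooth_zero [IsNoetherianRing R] (hc : IsUnit c₃) (hΔ : IsUnit (weierstrass d β c₂ c₃).Δ) :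
    Algebra.Smooth R (QuadraticAlgebra R[X] (zeroConst β c₂ c₃) (zeroLin d)) := by
  obtain ⟨u, v, h⟩ := exists_jacobian_of_forall (a := zeroConst β c₂ c₃) (b := zeroLin d)
    fun L _ _ x z h₁ h₂ h₃ => by
      simp only [zeroConst, zeroLin, map_add, map_neg, map_mul, map_pow, aeval_C,
        aeval_X, derivative_mul, derivative_X_pow, derivative_C,
        derivative_X, map_zero, map_natCast] at h₁ h₂ h₃
      push_cast at h₃
      refine false_of_singular_zero (hc.map (algebraMap R L)).ne_zero
        (map_Δ_weierstrass_ne_zero hΔ L) (t := x) (y := z) ?_ ?_ ?_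
      · linear_combination h₁
      · linear_combination h₂
      · simp at h₃
        linear_combination h₃
  exact QuadraticAlgebra.smooth_of_polynomial h

end Smooth

/-! ### Equations for the Kummer and Artin–Schreier covers -/

/-- An element satisfying the equation at infinity determines both charts: T²ω₁ satisfies that
equation multiplied by T⁴. The same statement serves the cover over R' and the target over k. -/
theorem IsSplit.exists_charts {R K : Type*} [CommRing R] [IsDomain R] [UniqueFactorizationMonoid R]
    [Field K] [Algebra R K] [IsFractionRing R K] {d β c₂ c₃ e₁ e₂ e₃ : R}
    (h : IsSplit d β c₂ c₃ e₁ e₂ e₃) {p : (RatFunc K)[X]} (hp : p.Monic) (hdeg : p.natDegree = 2)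
    {c e : RatFunc K} (hc : c ≠ 0) {ω₁ : AdjoinRoot p}
    (hω₁ : ω₁ = algebraMap (RatFunc K) _ c * AdjoinRoot.root p + algebraMap (RatFunc K) _ e)
    (hrel : ω₁ * ω₁ = algebraMap (RatFunc K) _ (aeval RatFunc.X⁻¹ (inftyConst β c₂ c₃)) +
      algebraMap (RatFunc K) _ (aeval RatFunc.X⁻¹ (inftyLin d)) * ω₁) :
    ∃ ω₀ : AdjoinRoot p, ω₁ = algebraMap (RatFunc K) _ RatFunc.X⁻¹ ^ 2 * ω₀ ∧
      (∃ φ₀ : QuadraticAlgebra R[X] (zeroConst β c₂ c₃) (zeroLin d) ≃ₐ[R]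
          chart R p (nearZero K), ∀ z, (φ₀ z : AdjoinRoot p) =
        algebraMap (RatFunc K) _ (aeval RatFunc.X z.re) +
          algebraMap (RatFunc K) _ (aeval RatFunc.X z.im) * ω₀) ∧
      ∃ φ₁ : QuadraticAlgebra R[X] (inftyConst β c₂ c₃) (inftyLin d) ≃ₐ[R]
          chart R p (nearInfty K), ∀ z, (φ₁ z : AdjoinRoot p) =
        algebraMap (RatFunc K) _ (aeval RatFunc.X⁻¹ z.re) +
          algebraMap (RatFunc K) _ (aeval RatFunc.X⁻¹ z.im) * ω₁ := by
  have hX : (RatFunc.X : RatFunc K) ≠ 0 := RatFunc.X_ne_zero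
  refine ⟨algebraMap (RatFunc K) _ (RatFunc.X ^ 2) * ω₁, ?_, ?_, ?_⟩
  · rw [← map_pow, ← mul_assoc, ← map_mul, inv_pow, inv_mul_cancel₀ (pow_ne_zero 2 hX), map_one,
      one_mul]
  · refine exists_equiv_chart_singleton isCoordinate_X hp hdeg (c := RatFunc.X ^ 2 * c)
      (e := RatFunc.X ^ 2 * e) (mul_ne_zero (pow_ne_zero 2 hX) hc) ?_ ?_ h.isNormal_zero
    · rw [hω₁, map_mul, map_mul]
      ring
    · have h₁ : aeval (RatFunc.X : RatFunc K) (zeroConst β c₂ c₃) =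
          RatFunc.X ^ 4 * aeval RatFunc.X⁻¹ (inftyConst β c₂ c₃) := by
        simp only [zeroConst, inftyConst, map_add, map_mul, map_pow, aeval_C, aeval_X]
        field_simp
        ring
      have h₂ : aeval (RatFunc.X : RatFunc K) (zeroLin d) =
          RatFunc.X ^ 2 * aeval RatFunc.X⁻¹ (inftyLin d) := by
        simp only [zeroLin, inftyLin, map_add, map_mul, map_pow, map_neg, map_one, aeval_C, aeval_X]
        field_simp
      rw [h₁, h₂]
      simp only [map_mul, map_pow]
      linear_combination algebraMap (RatFunc K) (AdjoinRoot p) RatFunc.X ^ 4 * hrel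
  · exact exists_equiv_chart_singleton isCoordinate_X.inv hp hdeg hc hω₁ hrel h.isNormal_infty

section

variable {k : Type*} [Field k] [CharP k 2]

/-- Since 2 = 4 = 0, all the divisibilities read 0 ∣ 0: every prime divides 2, and only that case of
the normality argument occurs. -/
theorem isSplit_of_charP_two {α β : k} (hα : α ≠ 0) : IsSplit 0 β 0 α 0 0 0 := by
  have h2 : (2 : k) = 0 := CharP.cast_eq_zero k 2
  have h4 : (4 : k) = 0 := by linear_combination 2 * h2
  constructor <;> simp [hα, h2, h4]
  exact ⟨1, one_ne_zero⟩

theorem exists_charts_artinSchreier {α β : k} (hα : α ≠ 0) :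
    ∃ η₀ η₁ : AdjoinRoot (artinSchreier α β),
      η₁ = algebraMap (RatFunc k) _ RatFunc.X⁻¹ ^ 2 * η₀ ∧
      (∃ φ₀ : QuadraticAlgebra k[X] (zeroConst β 0 α) (zeroLin 0) ≃ₐ[k]
          chart k (artinSchreier α β) (nearZero k), ∀ z, (φ₀ z : AdjoinRoot (artinSchreier α β)) =
        algebraMap (RatFunc k) _ (aeval RatFunc.X z.re) +
          algebraMap (RatFunc k) _ (aeval RatFunc.X z.im) * η₀) ∧
      ∃ φ₁ : QuadraticAlgebra k[X] (inftyConst β 0 α) (inftyLin 0) ≃ₐ[k]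
          chart k (artinSchreier α β) (nearInfty k), ∀ z, (φ₁ z : AdjoinRoot (artinSchreier α β)) =
        algebraMap (RatFunc k) _ (aeval RatFunc.X⁻¹ z.re) +
          algebraMap (RatFunc k) _ (aeval RatFunc.X⁻¹ z.im) * η₁ := by
  have h2 : (2 : k) = 0 := CharP.cast_eq_zero k 2
  have hform : artinSchreier α β =
      X ^ 2 - (X + C (RatFunc.C α / RatFunc.X ^ 3 + RatFunc.C β / RatFunc.X)) := by
    rw [artinSchreier, sub_sub]
  have hlt : (X + C (RatFunc.C α / RatFunc.X ^ 3 + RatFunc.C β / RatFunc.X) :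
      (RatFunc k)[X]).degree < (2 : ℕ) := by
    rw [degree_X_add_C]
    norm_num
  have hp : (artinSchreier α β).Monic := hform ▸ monic_X_pow_sub hlt
  have hdeg : (artinSchreier α β).natDegree = 2 := by
    rw [hform, natDegree_sub_eq_left_of_natDegree_lt, natDegree_X_pow]
    rw [natDegree_X_pow, natDegree_X_add_C]
    norm_num
  have hroot : AdjoinRoot.root (artinSchreier α β) ^ 2 - AdjoinRoot.root (artinSchreier α β) -
      algebraMap (RatFunc k) _ (RatFunc.C α / RatFunc.X ^ 3 + RatFunc.C β / RatFunc.X) = 0 := by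
    have := AdjoinRoot.eval₂_root (artinSchreier α β)
    rw [artinSchreier] at this
    simp only [eval₂_sub, eval₂_X_pow, eval₂_X, eval₂_C] at this
    exact this
  obtain ⟨η₀, h⟩ := (isSplit_of_charP_two (β := β) hα).exists_charts (K := k) hp hdeg
    (c := 1) (e := 0) one_ne_zero (ω₁ := AdjoinRoot.root (artinSchreier α β)) (by simp) (by
      have h₁ : aeval (RatFunc.X : RatFunc k)⁻¹ (inftyConst β 0 α) =
          RatFunc.C α / RatFunc.X ^ 3 + RatFunc.C β / RatFunc.X := by
        simp only [inftyConst, map_add, map_mul, map_pow, aeval_C, aeval_X, map_zero,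
          RatFunc.algebraMap_eq_C]
        field_simp
        ring
      have h₂ : aeval (RatFunc.X : RatFunc k)⁻¹ (inftyLin (0 : k)) = 1 := by
        have h3 : (2 : RatFunc k) = 0 := by
          rw [← map_ofNat (algebraMap k (RatFunc k)), h2, map_zero]
        simp only [inftyLin, map_add, map_mul, map_neg, map_one, map_zero]
        linear_combination -h3
      rw [h₁, h₂, map_one]
      linear_combination hroot)
  exact ⟨η₀, _, h⟩

end

section

variable {R : Type*} [CommRing R] {σ w U A β V : R} {j : ℕ}

/-- Here e₁ = 4A/σ⁴, e₂ = σ²U, e₃ = e₂ + 4V/σ⁴ and d = -σ²U + 2w/σ, written without denominators.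
The formula for V matches the coefficient of x; w² = UV cancels 4UV/σ² against the square of 2w/σ,
and c₂ is a quarter of what is left; c₃ is -e₁e₂e₃/4. The eᵢ and their differences are powers of σ
times units and divide 4 = σ^(2j+8). -/
theorem isSplit_of_two_eq [IsDomain R] [IsLocalRing R] (h2 : 2 = σ ^ j * σ ^ 4) (hw : w ^ 2 = U * V)
    (hV : V = -A - σ ^ 3 * w - σ ^ 4 * β) (hσ : ¬ IsUnit σ) (hA : IsUnit A) (hU : IsUnit U) (hVu : IsUnit V) :
    IsSplit (σ ^ 2 * (-U + σ * σ ^ j * w)) β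
      (σ * U * w + σ ^ j * σ ^ 2 * A * U + (σ ^ j) ^ 2 * A * V)
      (-(A * U * (U + (σ ^ j) ^ 2 * σ ^ 2 * V)))
      ((σ ^ j) ^ 2 * σ ^ 4 * A) (σ ^ 2 * U) (σ ^ 2 * U + (σ ^ j) ^ 2 * σ ^ 4 * V) := by
  have hσm : σ ∈ IsLocalRing.maximalIdeal R := hσ
  have hadd : ∀ {x y : R}, IsUnit x → IsUnit (x + σ * y) := fun {x y} hx => by
    by_contra hxy
    have h1 : x + σ * y ∈ IsLocalRing.maximalIdeal R := hxy
    have h2 := sub_mem h1 (Ideal.mul_mem_right y _ hσm)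
    rw [add_sub_cancel_right] at h2
    exact h2 hx
  have hdvd : ∀ {x y z : R}, IsUnit y → x = z * y → ∀ {t}, z ∣ t → x ∣ t := fun hy hx _ ht => by
    rw [hx]
    exact (hy.mul_right_dvd).mpr ht
  have h4 : ∀ i ≤ 2, ∀ l ≤ 8, (σ ^ j) ^ i * σ ^ l ∣ 2 ^ 2 := fun i hi l hl => by
    rw [h2, mul_pow, ← pow_mul σ 4 2]
    exact mul_dvd_mul (pow_dvd_pow _ hi) (pow_dvd_pow _ hl)
  have h5 : σ ^ 2 ∣ 2 ^ 2 := by simpa using h4 0 (by norm_num) 2 (by norm_num)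
  constructor
  · refine neg_ne_zero.mpr (mul_ne_zero (mul_ne_zero hA.ne_zero hU.ne_zero) ?_)
    have : IsUnit (U + σ * ((σ ^ j) ^ 2 * σ * V)) := hadd hU
    convert this.ne_zero using 1
    ring
  · refine ⟨j + 4, ?_⟩
    rw [h2, ← pow_add]
    exact pow_dvd_pow_of_dvd ⟨σ * (-U + σ * σ ^ j * w), by ring⟩ _
  · linear_combination (-σ ^ 3 * σ ^ j * w - β * (2 + σ ^ j * σ ^ 4)) * h2 -
      (σ ^ j) ^ 2 * σ ^ 4 * hV
  · linear_combination (-2 * σ * U * w - 2 * σ ^ j * σ ^ 2 * A * U -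
      (σ ^ j) ^ 2 * A * V * (2 + σ ^ j * σ ^ 4)) * h2 - (σ ^ j) ^ 2 * σ ^ 6 * hw
  · linear_combination A * U * (U + (σ ^ j) ^ 2 * σ ^ 2 * V) * (2 + σ ^ j * σ ^ 4) * h2
  · exact hdvd hA rfl (h4 2 le_rfl 4 (by norm_num))
  · exact hdvd hU rfl h5
  · exact hdvd (hadd (x := U) (y := (σ ^ j) ^ 2 * σ * V) hU) (z := σ ^ 2) (by ring) h5
  · exact hdvd (hadd (x := -U) (y := (σ ^ j) ^ 2 * σ * A) hU.neg) (z := σ ^ 2) (by ring) h5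
  · exact hdvd (hadd (x := -U) (y := (σ ^ j) ^ 2 * σ * (A - V)) hU.neg) (z := σ ^ 2) (by ring) h5
  · exact hdvd hVu.neg (z := (σ ^ j) ^ 2 * σ ^ 4) (by ring) (h4 2 le_rfl 4 (by norm_num))

end

theorem IsSplit.exists_charts_kummer {R K : Type*} [CommRing R] [IsDomain R]
    [UniqueFactorizationMonoid R] [Field K] [CharZero K] [Algebra R K] [IsFractionRing R K]
    {d β c₂ c₃ e₁ e₂ e₃ : R} (h : IsSplit d β c₂ c₃ e₁ e₂ e₃) {p : (RatFunc K)[X]}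
    (hpdef : p = kummer R K ![0, e₁, e₂, e₃]) :
    ∃ ω₀ ω₁ : AdjoinRoot p, ω₁ = algebraMap (RatFunc K) _ RatFunc.X⁻¹ ^ 2 * ω₀ ∧
      (∃ φ₀ : QuadraticAlgebra R[X] (zeroConst β c₂ c₃) (zeroLin d) ≃ₐ[R]
          chart R p (nearZero K), ∀ z, (φ₀ z : AdjoinRoot p) =
        algebraMap (RatFunc K) _ (aeval RatFunc.X z.re) +
          algebraMap (RatFunc K) _ (aeval RatFunc.X z.im) * ω₀) ∧
      ∃ φ₁ : QuadraticAlgebra R[X] (inftyConst β c₂ c₃) (inftyLin d) ≃ₐ[R]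
          chart R p (nearInfty K), ∀ z, (φ₁ z : AdjoinRoot p) =
        algebraMap (RatFunc K) _ (aeval RatFunc.X⁻¹ z.re) +
          algebraMap (RatFunc K) _ (aeval RatFunc.X⁻¹ z.im) * ω₁ := by
  set ι := algebraMap R (RatFunc K) with hι
  set f : RatFunc K := (1 - ι e₁ * RatFunc.X⁻¹) * (1 - ι e₂ * RatFunc.X⁻¹) *
    (1 - ι e₃ * RatFunc.X⁻¹) with hf
  have hform : p = X ^ 2 - C f := by
    rw [hpdef, kummer, Fin.prod_univ_four]
    congr 2
    simp [hf, hι, mul_assoc]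
  have hp : p.Monic := hform ▸ monic_X_pow_sub_C f two_ne_zero
  have hdeg : p.natDegree = 2 := hform ▸ natDegree_X_pow_sub_C
  have hroot : AdjoinRoot.root p ^ 2 = algebraMap (RatFunc K) _ f := by
    have := (congrArg (eval₂ (AdjoinRoot.of p) (AdjoinRoot.root p)) hform).symm.trans
      (AdjoinRoot.eval₂_root p)
    simp only [eval₂_sub, eval₂_X_pow, eval₂_C] at this
    exact sub_eq_zero.mp this
  have h2 : (2 : RatFunc K) ≠ 0 := two_ne_zero
  set H : RatFunc K := 1 + ι d * RatFunc.X⁻¹ with hH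
  have hlin : aeval (RatFunc.X : RatFunc K)⁻¹ (inftyLin d) = -H := by
    simp [inftyLin, hH, hι]
  have hconst : f = H ^ 2 + 4 * aeval (RatFunc.X : RatFunc K)⁻¹ (inftyConst β c₂ c₃) := by
    have i₁ := congrArg ι h.coeff_one
    have i₂ := congrArg ι h.coeff_two
    have i₃ := congrArg ι h.coeff_three
    simp only [map_neg, map_add, map_mul, map_pow, map_ofNat] at i₁ i₂ i₃
    simp only [inftyConst, map_add, map_mul, map_pow, aeval_C, aeval_X, ← hι]
    rw [hf, hH]
    linear_combination RatFunc.X⁻¹ * i₁ + RatFunc.X⁻¹ ^ 2 * i₂ + RatFunc.X⁻¹ ^ 3 * i₃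
  -- The generator is (Y - H)/2, which turns Y² = H² + 4g into z² + Hz = g.
  obtain ⟨ω₀, hω⟩ := h.exists_charts (K := K) hp hdeg (c := 2⁻¹) (e := -(2⁻¹ * H))
    (inv_ne_zero h2) rfl (by
      rw [hlin]
      have hc : aeval (RatFunc.X : RatFunc K)⁻¹ (inftyConst β c₂ c₃) =
          2⁻¹ ^ 2 * (f - H ^ 2) := by
        rw [hconst]
        field_simp
        ring
      have h3 : algebraMap (RatFunc K) (AdjoinRoot p) 2⁻¹ * 2 = 1 := by
        rw [← map_ofNat (algebraMap (RatFunc K) (AdjoinRoot p)), ← map_mul, inv_mul_cancel₀ h2,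
          map_one]
      rw [hc]
      simp only [map_mul, map_sub, map_neg, map_pow]
      rw [← hroot]
      generalize algebraMap (RatFunc K) (AdjoinRoot p) 2⁻¹ = t at *
      generalize algebraMap (RatFunc K) (AdjoinRoot p) H = s at *
      linear_combination (-(t * s * AdjoinRoot.root p) + t * s ^ 2) * h3)
  exact ⟨ω₀, _, hω⟩

theorem isUnit_iff_of_surjective {k R : Type*} [Field k] [CommRing R] [IsLocalRing R] [Algebra R k]
    (hk : Function.Surjective (algebraMap R k)) {x : R} : IsUnit x ↔ algebraMap R k x ≠ 0 := by
  have h := IsLocalRing.eq_maximalIdeal (RingHom.ker_isMaximal_of_surjective _ hk)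
  rw [← not_iff_not, not_not, ← RingHom.mem_ker, h]
  exact Iff.rfl

theorem weierstrass_Δ_of_charP_two {k : Type*} [Field k] [CharP k 2] (α β : k) :
    (weierstrass 0 β 0 α).Δ = α ^ 4 := by
  have h2 : (2 : k) = 0 := CharP.cast_eq_zero k 2
  simp only [weierstrass, WeierstrassCurve.Δ, WeierstrassCurve.b₂, WeierstrassCurve.b₄,
    WeierstrassCurve.b₆, WeierstrassCurve.b₈]
  linear_combination (-32 * β ^ 3 * α ^ 3 - 14 * α ^ 4) * h2

/-- Good reduction of the curve `Y² = (1 - e₁x)(1 - e₂x)(1 - e₃x)`, `x = T⁻¹`, to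
`z² - z = αt⁻³ + βt⁻¹`. -/
theorem IsSplit.hasGoodReduction {k R K : Type*} [Field k] [CharP k 2] [CommRing R] [IsDomain R]
    [IsDiscreteValuationRing R] [Algebra R k] (hk : Function.Surjective (algebraMap R k)) [Field K]
    [CharZero K] [Algebra R K] [IsFractionRing R K] {d β c₂ c₃ e₁ e₂ e₃ : R}
    (h : IsSplit d β c₂ c₃ e₁ e₂ e₃) (hd : algebraMap R k d = 0) (hc₂ : algebraMap R k c₂ = 0)
    (hc₃ : algebraMap R k c₃ ≠ 0) :
    HasGoodReduction R (kummer R K ![0, e₁, e₂, e₃]) ∧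
      HasSpecialFibre R (kummer R K ![0, e₁, e₂, e₃])
        (artinSchreier (algebraMap R k c₃) (algebraMap R k β)) := by
  obtain ⟨ω₀, ω₁, hω, ⟨φ₀, hφ₀⟩, φ₁, hφ₁⟩ := h.exists_charts_kummer (K := K) rfl
  obtain ⟨η₀, η₁, hη, ⟨φ₀', hφ₀'⟩, φ₁', hφ₁'⟩ :=
    exists_charts_artinSchreier (β := algebraMap R k β) hc₃
  have hΔ : IsUnit (weierstrass d β c₂ c₃).Δ := by
    rw [isUnit_iff_of_surjective hk, ← WeierstrassCurve.map_Δ]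
    have : (weierstrass d β c₂ c₃).map (algebraMap R k) =
        weierstrass 0 (algebraMap R k β) 0 (algebraMap R k c₃) := by
      simp [weierstrass, WeierstrassCurve.map, hd, hc₂]
    rw [this, weierstrass_Δ_of_charP_two]
    exact pow_ne_zero 4 hc₃
  have hsm₀ := smooth_zero ((isUnit_iff_of_surjective hk).mpr hc₃) hΔ
  have hsm₁ := smooth_infty hΔ
  refine ⟨⟨Algebra.Smooth.of_equiv φ₀, Algebra.Smooth.of_equiv φ₁⟩, ?_⟩
  obtain ⟨π, hπ⟩ := IsDiscreteValuationRing.exists_irreducible R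
  have hker : ∀ r, algebraMap R k r = 0 ↔ π ∣ r := fun r => by
    rw [← not_iff_not, ← ne_eq, ← isUnit_iff_of_surjective hk, ← not_iff_not, not_not,
      ← Ideal.mem_span_singleton, ← hπ.maximalIdeal_eq]
    exact Iff.rfl
  exact HasSpecialFibre.of_charts hk ((hker π).mpr dvd_rfl) (fun r => (hker r).mp)
    (by simp [zeroConst, hc₂]) (by simp [zeroLin, hd]) (by simp [inftyConst, hc₂])
    (by simp [inftyLin, hd]) hω hη φ₀ hφ₀ φ₁ hφ₁ φ₀' hφ₀' φ₁' hφ₁'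

end DoubleCover

/-! ### The extension R' and the unit V -/

/-- A square root `σ` of `ρ` and a solution of the quadratic equation
`w² = U (-A - σ³w - σ⁴β)` exist in the integral closure in some finite extension. -/
theorem exists_integralClosure_roots {R : Type u} [CommRing R] [IsDomain R] (ρ U A β : R) :
    ∃ (L : IntermediateField (FractionRing R) (AlgebraicClosure (FractionRing R)))
      (_ : FiniteDimensional (FractionRing R) L) (σ w : integralClosure R L),
      σ ^ 2 = algebraMap R _ ρ ∧
      w ^ 2 = algebraMap R _ U * (-algebraMap R _ A - σ ^ 3 * w - σ ^ 4 * algebraMap R _ β) := by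
  set Ω := AlgebraicClosure (FractionRing R)
  obtain ⟨σ, hσ⟩ := IsAlgClosed.exists_pow_nat_eq (algebraMap R Ω ρ) two_pos
  have hσint : IsIntegral R σ := ⟨X ^ 2 - C ρ, monic_X_pow_sub_C ρ two_ne_zero, by simp [hσ]⟩
  let σ' : integralClosure R Ω := ⟨σ, hσint⟩
  let b : integralClosure R Ω := algebraMap R _ U * σ' ^ 3
  let c : integralClosure R Ω := algebraMap R _ U * (algebraMap R _ A + σ' ^ 4 * algebraMap R _ β)
  let f : (integralClosure R Ω)[X] := X ^ 2 + (C b * X + C c)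
  have hf : f.Monic := monic_X_pow_add (degree_linear_le.trans_lt (by norm_num))
  have hfdeg : (f.map (algebraMap (integralClosure R Ω) Ω)).degree ≠ 0 := by
    rw [hf.degree_map, degree_add_eq_left_of_degree_lt, degree_X_pow]
    · norm_num
    · rw [degree_X_pow]
      exact degree_linear_le.trans_lt (by norm_num)
  obtain ⟨w, hw⟩ := IsAlgClosed.exists_root _ hfdeg
  have hw' : eval₂ (algebraMap (integralClosure R Ω) Ω) w f = 0 := by
    rwa [IsRoot, eval_map] at hw
  -- The quadratic equation for w is monic over the integral closure of R, since its coefficients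
  -- involve σ.
  have hwint : IsIntegral R w :=
    isIntegral_trans (A := integralClosure R Ω) w ⟨f, hf, hw'⟩
  have hrel : w ^ 2 = algebraMap R Ω U *
      (-algebraMap R Ω A - σ ^ 3 * w - σ ^ 4 * algebraMap R Ω β) := by
    simp only [f, eval₂_add, eval₂_mul, eval₂_X_pow, eval₂_C, eval₂_X] at hw'
    have hb : algebraMap (integralClosure R Ω) Ω b = algebraMap R Ω U * σ ^ 3 := rfl
    have hc : algebraMap (integralClosure R Ω) Ω c =
      algebraMap R Ω U * (algebraMap R Ω A + σ ^ 4 * algebraMap R Ω β) := rfl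
    rw [hb, hc] at hw'
    linear_combination hw'
  let L := IntermediateField.adjoin (FractionRing R) ({σ, w} : Set Ω)
  have hfin : FiniteDimensional (FractionRing R) L :=
    IntermediateField.finiteDimensional_adjoin fun x hx => by
      rcases hx with rfl | rfl
      · exact hσint.tower_top
      · exact hwint.tower_top
  have : IsScalarTower R L Ω := IsScalarTower.of_algebraMap_eq fun _ => rfl
  have hinj : Function.Injective (algebraMap L Ω) := (algebraMap L Ω).injective
  let σL : L := ⟨σ, IntermediateField.subset_adjoin _ _ (by simp)⟩
  let wL : L := ⟨w, IntermediateField.subset_adjoin _ _ (by simp)⟩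
  have hσL : IsIntegral R σL := (isIntegral_algebraMap_iff hinj).mp hσint
  have hwL : IsIntegral R wL := (isIntegral_algebraMap_iff hinj).mp hwint
  refine ⟨L, hfin, ⟨σL, hσL⟩, ⟨wL, hwL⟩, ?_, ?_⟩
  · exact Subtype.ext (Subtype.ext hσ)
  · exact Subtype.ext (Subtype.ext hrel)

theorem DoubleCover.exists_hasGoodReduction {k R K : Type*} [Field k] [CharP k 2] [CommRing R]
    [IsDomain R] [IsDiscreteValuationRing R] [Algebra R k]
    (hk : Function.Surjective (algebraMap R k)) [Field K] [CharZero K] [Algebra R K]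
    [IsFractionRing R K] {r : ℕ} (hr : 3 ≤ r) {ρ σ w A U β : R} (hρ : ρ ^ (2 * r - 1) = 2)
    (hσ : σ ^ 2 = ρ) (hw : w ^ 2 = U * (-A - σ ^ 3 * w - σ ^ 4 * β)) (hA : IsUnit A)
    (hU : IsUnit U) :
    ∃ V : R, IsUnit V ∧
      HasGoodReduction R
        (kummer R K ![0, ρ ^ (4 * r - 4) * A, ρ * U, ρ * U + ρ ^ (4 * r - 4) * V]) ∧
      HasSpecialFibre R
        (kummer R K ![0, ρ ^ (4 * r - 4) * A, ρ * U, ρ * U + ρ ^ (4 * r - 4) * V])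
        (artinSchreier (algebraMap R k (-A * U ^ 2)) (algebraMap R k β)) := by
  -- With r = 3 + s the exponent j of `isSplit_of_two_eq` is 4r - 6 = 4s + 6: then 2 = σ^(4r-2) =
  -- σ^(j+4) and ρ^(4r-4) = σ^(8r-8) = σ^(2j+4).
  obtain ⟨s, rfl⟩ := Nat.exists_eq_add_of_le hr
  have h2 : (2 : R) = σ ^ (4 * s + 6) * σ ^ 4 := by
    rw [← hρ, ← hσ, ← pow_mul, ← pow_add]
    congr 1
    lia
  have hpow : ρ ^ (4 * (3 + s) - 4) = (σ ^ (4 * s + 6)) ^ 2 * σ ^ 4 := by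
    rw [← hσ, ← pow_mul, ← pow_mul, ← pow_add]
    congr 1
    lia
  have hσ0 : algebraMap R k σ = 0 := by
    have h := congrArg (algebraMap R k) h2
    rw [map_ofNat, show (2 : k) = 0 from CharP.cast_eq_zero k 2, ← pow_add, map_pow] at h
    exact pow_eq_zero_iff (by lia) |>.mp h.symm
  have hσu : ¬ IsUnit σ := by
    rw [isUnit_iff_of_surjective hk]
    exact fun h => h hσ0
  have hVu : IsUnit (-A - σ ^ 3 * w - σ ^ 4 * β) := by
    rw [isUnit_iff_of_surjective hk] at hA ⊢
    simpa [hσ0] using hA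
  -- The witness is V = -A - σ³w - σ⁴β, a unit because it reduces to the class of -A.
  refine ⟨_, hVu, ?_⟩
  have hsplit := isSplit_of_two_eq h2 hw rfl hσu hA hU hVu
  rw [hpow, ← hσ]
  have hc₃ : algebraMap R k (-(A * U * (U + (σ ^ (4 * s + 6)) ^ 2 * σ ^ 2 *
      (-A - σ ^ 3 * w - σ ^ 4 * β)))) = algebraMap R k (-A * U ^ 2) := by
    simp [hσ0]
    ring
  rw [← hc₃]
  refine hsplit.hasGoodReduction hk (by simp [hσ0]) (by simp [hσ0]) ?_
  rw [hc₃, ← isUnit_iff_of_surjective hk]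
  exact hA.neg.mul (hU.pow 2)

theorem lemma5 {k : Type v} [Field k] [IsAlgClosed k] [CharP k 2]
    {R : Type u} [CommRing R] [IsDomain R] [IsDiscreteValuationRing R]
    [IsAdicComplete (IsLocalRing.maximalIdeal R) R] [CharZero R]
    [Algebra R k] (hk : Function.Surjective (algebraMap R k))
    (r : ℕ) (hr : 3 ≤ r) (ρ : R) (hρ : ρ ^ (2 * r - 1) = 2)
    (α β : k) (hα : α ≠ 0) (A U : R) (hA : IsUnit A) (hU : IsUnit U)
    (hAU : algebraMap R k (-A * U ^ 2) = α) (hUA : IsUnit (U - A)) :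
    ∃ (R' : Type u) (_ : CommRing R') (_ : IsDomain R') (_ : IsDiscreteValuationRing R')
      (_ : Algebra R R') (_ : Algebra R' k),
      -- `R'` is a finite extension of `R`, complete and with the same residue field `k`
      Function.Injective (algebraMap R R') ∧ Module.Finite R R' ∧
      IsAdicComplete (IsLocalRing.maximalIdeal R') R' ∧ IsScalarTower R R' k ∧
      ∃ V : R', IsUnit V ∧
        letI ρ' : R' := algebraMap R R' ρ
        letI A' : R' := algebraMap R R' A
        letI U' : R' := algebraMap R R' U
        letI T : Fin 4 → R' :=
          ![0, ρ' ^ (4 * r - 4) * A', ρ' * U', ρ' * U' + ρ' ^ (4 * r - 4) * V]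
        letI p := DoubleCover.kummer R' (FractionRing R') T
        DoubleCover.HasGoodReduction R' p ∧
        DoubleCover.HasSpecialFibre R' p (DoubleCover.artinSchreier α β) := by
  -- Any lift of β to R serves as the linear coefficient of g.
  obtain ⟨β', rfl⟩ := hk β
  obtain ⟨L, _, σ, w, hσ, hw⟩ := exists_integralClosure_roots ρ U A β'
  obtain ⟨hfin, hdvr, hcomp, halg, htower⟩ :=
    IsDiscreteValuationRing.integralClosure_of_isAdicComplete hk (FractionRing R) L
  have hinjL : Function.Injective (algebraMap R L) := by
    rw [IsScalarTower.algebraMap_eq R (FractionRing R) L]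
    exact (algebraMap (FractionRing R) L).injective.comp (IsFractionRing.injective R _)
  have hinj : Function.Injective (algebraMap R (integralClosure R L)) :=
    Function.Injective.of_comp (f := algebraMap (integralClosure R L) L) (by
      rw [← RingHom.coe_comp, ← IsScalarTower.algebraMap_eq]
      exact hinjL)
  have hchar : CharZero (integralClosure R L) := charZero_of_injective_algebraMap hinj
  have hchar' : CharZero (FractionRing (integralClosure R L)) :=
    charZero_of_injective_algebraMap (IsFractionRing.injective (integralClosure R L) _)
  refine ⟨integralClosure R L, inferInstance, inferInstance, hdvr, inferInstance, halg, hinj, hfin,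
    hcomp, htower, ?_⟩
  have hmap : ∀ x : R, algebraMap R k x =
      algebraMap (integralClosure R L) k (algebraMap R (integralClosure R L) x) := fun x =>
    IsScalarTower.algebraMap_apply _ _ _ x
  have hk' : Function.Surjective (algebraMap (integralClosure R L) k) := fun y => by
    obtain ⟨x, rfl⟩ := hk y
    exact ⟨algebraMap R _ x, (hmap x).symm⟩
  have := DoubleCover.exists_hasGoodReduction (K := FractionRing (integralClosure R L)) hk' hr
    (by rw [← map_pow, hρ, map_ofNat]) hσ hw (hA.map _) (hU.map _)
  have hα' : algebraMap (integralClosure R L) k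
      (-algebraMap R (integralClosure R L) A * algebraMap R (integralClosure R L) U ^ 2) = α := by
    rw [← hAU, hmap]
    simp only [map_mul, map_neg, map_pow]
  rwa [hα', ← hmap] at this

end
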